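/- Let $(X,d)$ be a proper cocompact CAT(0) space; that is, $X$ is a geodesic metric space whose geodesic triangles are no fatter than their comparison triangles in the Euclidean plane, all closed balls of $X$ are compact, and there is a compact set $C\subset X$ such that the sets $h(C)$, with $h$ ranging over all isometries of $X$ onto itself, cover $X$. Let $i\ge 0$ be an integer, and let $H_c^i(X)$ denote the integral (singular) cohomology of $X$ with compact supports: a singular cochain has compact support contained in $U\subset X$ if there is a compact set $K\subset U$ such that the cochain vanishes on every singular simplex lying in $X\setminus K$, and $H_c^i(X)$ is the group of compactly supported $i$-cocycles modulo the coboundaries of compactly supported $(i-1)$-cochains (the only $(-1)$-cochain being $0$). Let $B(p,r)$ denote the open ball of radius $r$ centred at $p$. If $H_c^i(X)=0$, then $H_c^i(X)$ is uniformly trivial: for every $r>0$ there is $s>0$ such that for every $p\in X$, every integral singular $i$-cocycle with compact support contained in $B(p,r)$ is the coboundary of an integral singular $(i-1)$-cochain with compact support contained in $B(p,s)$. -/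

import Mathlib

/-! ### CAT(0) spaces -/

/-- `γ`, restricted to `[0, d(x, y)]`, is a geodesic from `x` to `y` parametrised by arc length
(the values of `γ` outside this interval are irrelevant). -/
structure IsGeodesicSegment {X : Type*} [MetricSpace X] (γ : ℝ → X) (x y : X) : Prop where
  source : γ 0 = x
  target : γ (dist x y) = y
  isometry : ∀ s ∈ Set.Icc 0 (dist x y), ∀ t ∈ Set.Icc 0 (dist x y), dist (γ s) (γ t) = |s - t|

/-- A CAT(0) space: a geodesic metric space in which every geodesic triangle is no fatter than its
comparison triangle `x' y' z'` in the Euclidean plane. It is enough to compare points `γ s`, `η t`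
on two sides of the triangle that issue from a common vertex `x`, as any two different sides share
a vertex, and two points on one side have the same distance as their comparison points. -/
structure IsCAT0 (X : Type*) [MetricSpace X] : Prop where
  exists_geodesic : ∀ x y : X, ∃ γ : ℝ → X, IsGeodesicSegment γ x y
  comparison : ∀ (x y z : X) (γ η : ℝ → X), IsGeodesicSegment γ x y → IsGeodesicSegment η x z →
    ∀ x' y' z' : EuclideanSpace ℝ (Fin 2),
      dist x' y' = dist x y → dist y' z' = dist y z → dist x' z' = dist x z →
    ∀ s ∈ Set.Icc 0 (dist x y), ∀ t ∈ Set.Icc 0 (dist x z),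
    ∀ p' ∈ segment ℝ x' y', ∀ q' ∈ segment ℝ x' z', dist x' p' = s → dist x' q' = t →
      dist (γ s) (η t) ≤ dist p' q'

/-- There is a compact set whose translates under the full isometry group cover `X`. -/
def IsCocompactSpace (X : Type*) [MetricSpace X] : Prop :=
  ∃ C : Set X, IsCompact C ∧ ⋃ h : X ≃ᵢ X, h '' C = Set.univ

/-! ### Integral singular cohomology with compact supports -/

/-- Singular `n`-simplices of `X`. -/
abbrev SingSimplex (X : Type*) [TopologicalSpace X] (n : ℕ) : Type _ :=
  C(stdSimplex ℝ (Fin (n + 1)), X)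

/-- The `k`-th face of a singular simplex, opposite to the `k`-th vertex. -/
noncomputable def SingSimplex.face {X : Type*} [TopologicalSpace X] {n : ℕ}
    (σ : SingSimplex X (n + 1)) (k : Fin (n + 2)) : SingSimplex X n :=
  σ.comp ⟨stdSimplex.map k.succAbove, stdSimplex.continuous_map k.succAbove⟩

/-- Integral singular `n`-cochains: homomorphisms to `ℤ` from the free abelian group on the
singular `n`-simplices, that is, integer functions on singular simplices. -/
abbrev SingCochain (X : Type*) [TopologicalSpace X] (n : ℕ) : Type _ :=
  SingSimplex X n → ℤ

/-- The coboundary `(δ c)(σ) = ∑ₖ (-1)ᵏ c(∂ₖ σ)`. -/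
noncomputable def singCoboundary (X : Type*) [TopologicalSpace X] (n : ℕ) :
    SingCochain X n →+ SingCochain X (n + 1) where
  toFun c σ := ∑ k : Fin (n + 2), (-1) ^ (k : ℕ) * c (σ.face k)
  map_zero' := by ext σ; simp
  map_add' c d := by ext σ; simp [mul_add, Finset.sum_add_distrib]

/-- The cochains whose compact support lies in `U`: those that, for some compact `K ⊆ U`, vanish on
every singular simplex in `X ∖ K`. -/
def cochainsIn {X : Type*} [MetricSpace X] (U : Set X) (n : ℕ) : AddSubgroup (SingCochain X n) where
  carrier := {c | ∃ K : Set X, IsCompact K ∧ K ⊆ U ∧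
    ∀ σ : SingSimplex X n, Set.range σ ⊆ Kᶜ → c σ = 0}
  zero_mem' := ⟨∅, isCompact_empty, Set.empty_subset _, fun _ _ => rfl⟩
  add_mem' := by
    rintro c d ⟨K, hK, hKU, hc⟩ ⟨L, hL, hLU, hd⟩
    refine ⟨K ∪ L, hK.union hL, Set.union_subset hKU hLU, fun σ hσ => ?_⟩
    rw [Set.compl_union, Set.subset_inter_iff] at hσ
    simp [hc σ hσ.1, hd σ hσ.2]
  neg_mem' := by
    rintro c ⟨K, hK, hKU, hc⟩
    exact ⟨K, hK, hKU, fun σ hσ => by simp [hc σ hσ]⟩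

/-- The `n`-cocycles whose compact support lies in `U`. -/
noncomputable def cocyclesIn {X : Type*} [MetricSpace X] (U : Set X) (n : ℕ) :
    AddSubgroup (SingCochain X n) :=
  cochainsIn U n ⊓ (singCoboundary X n).ker

/-- The coboundaries of the `(n-1)`-cochains whose compact support lies in `U`; the only cochain of
degree `-1` is zero. -/
noncomputable def coboundariesIn {X : Type*} [MetricSpace X] (U : Set X) :
    (n : ℕ) → AddSubgroup (SingCochain X n)
  | 0 => ⊥
  | n + 1 => (cochainsIn U n).map (singCoboundary X n)

theorem SingSimplex.face_face {X : Type*} [TopologicalSpace X] {n : ℕ}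
    (σ : SingSimplex X (n + 2)) {i j : Fin (n + 2)} (h : i ≤ j) :
    (σ.face j.succ).face i = (σ.face i.castSucc).face j := by
  ext x
  simp only [SingSimplex.face, ContinuousMap.comp_apply, ContinuousMap.coe_mk,
    stdSimplex.map_comp_apply]
  congr 2
  funext k
  simp only [Function.comp, Fin.succAbove, Fin.lt_def, Fin.le_def, Fin.ext_iff] at *
  split_ifs <;> simp_all <;> omega

theorem singCoboundary_comp (X : Type*) [TopologicalSpace X] (n : ℕ) (c : SingCochain X n) :
    singCoboundary X (n + 1) (singCoboundary X n c) = 0 := by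
  funext σ
  simp only [singCoboundary, AddMonoidHom.coe_mk, ZeroHom.coe_mk, Pi.zero_apply, Finset.mul_sum]
  rw [← Finset.sum_product', Finset.univ_product_univ]
  let S : Finset (Fin (n + 3) × Fin (n + 2)) := {ij | (ij.1 : ℕ) ≤ (ij.2 : ℕ)}
  rw [← Finset.sum_add_sum_compl S, ← eq_neg_iff_add_eq_zero, ← Finset.sum_neg_distrib]
  refine Finset.sum_bij'
    (fun ij hij => (ij.2.succ, ij.1.castLT (lt_of_le_of_lt (Finset.mem_filter.mp hij).2 ij.2.2)))
    (fun ij hij => (ij.2.castSucc, ij.1.pred (by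
      rintro h
      simp [S, h] at hij))) ?_ ?_ ?_ ?_ ?_
  · rintro ⟨i, j⟩ hij
    simp [S] at hij ⊢
    omega
  · rintro ⟨i, j⟩ hij
    simp [S] at hij ⊢
    omega
  · rintro ⟨i, j⟩ hij
    simp
  · rintro ⟨i, j⟩ hij
    simp
  · rintro ⟨i, j⟩ hij
    have hij' : (i : ℕ) ≤ j := by simpa [S] using hij
    have key := σ.face_face (i := i.castLT (lt_of_le_of_lt hij' j.2)) (j := j) hij'
    rw [Fin.castSucc_castLT] at key
    simp only [key, Fin.val_succ, Fin.val_castLT, pow_succ]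
    ring

theorem coboundariesIn_le_cocyclesIn {X : Type*} [MetricSpace X] (U : Set X) (n : ℕ) :
    coboundariesIn U n ≤ cocyclesIn U n := by
  cases n with
  | zero => exact bot_le
  | succ n =>
    rintro _ ⟨c, ⟨K, hK, hKU, hc⟩, rfl⟩
    refine ⟨⟨K, hK, hKU, fun σ hσ => ?_⟩, singCoboundary_comp X n c⟩
    have hface : ∀ k, c (σ.face k) = 0 := by
      intro k
      apply hc
      rintro _ ⟨x, rfl⟩
      exact hσ ⟨_, rfl⟩
    simp [singCoboundary, hface]

/-- Integral cohomology with compact supports `H_c^n(X)`: compactly supported `n`-cocycles modulo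
coboundaries of compactly supported `(n-1)`-cochains. -/
abbrev CompactCohomology (X : Type*) [MetricSpace X] (n : ℕ) : Type _ :=
  cocyclesIn (Set.univ : Set X) n ⧸
    (coboundariesIn (Set.univ : Set X) n).addSubgroupOf (cocyclesIn Set.univ n)

/-- `H_c^n(X)` is uniformly trivial: for every `r > 0` there is `s > 0` such that every `n`-cocycle
with compact support contained in a ball `B(p, r)` is the coboundary of a cochain whose compact
support lies in `B(p, s)`. -/
def UniformlyTrivialCompactCohomology (X : Type*) [MetricSpace X] (n : ℕ) : Prop :=
  ∀ r : ℝ, 0 < r → ∃ s : ℝ, 0 < s ∧ ∀ p : X, ∀ z : SingCochain X n,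
    z ∈ cocyclesIn (Metric.ball p r) n → z ∈ coboundariesIn (Metric.ball p s) n

/-! By cocompactness, isometries reduce everything to balls `B(p₀, R)` around one point
(`exists_ball_of_coboundariesIn`). In positive degree the key is finite detection: a homomorphism
`Θ` to a free abelian group of finite rank such that every cocycle supported in `B(p₀, R)` and
killed by `Θ` bounds in `B(p₀, R + 4)`. The cocycles supported in `B(p₀, R)` that bound in `B(p₀,
s)`, for s = 0, 1, 2, …, have increasing images under `Θ`. These stabilise at some `s₀` because the
target is Noetherian, and vanishing cohomology makes the stable image the image of all cocycles
supported in `B(p₀, R)`. So each of them is the sum of one that bounds in `B(p₀, s₀)` and one in the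
kernel of `Θ`.

To find `Θ`, note that coning to `p₀` turns a cocycle `z` into a primitive `f`, itself a cocycle off
`B(p₀, R)`. Replace every simplex by an iterated geodesic cone whose apexes are vertices moved
towards `p₀` into a finite net. Only finitely many chains arise, and `Θ z` records `f` on them.
Balls in a CAT(0) space are convex, so for a small simplex at distance at least R + 3 from `p₀` the
homotopy to its replacement avoids `B(p₀, R)`. If `Θ z = 0`, then on such simplices `f` agrees with
a coboundary (`exists_eq_augCobd`). The difference vanishes on small simplices and is therefore a
coboundary there, by barycentric subdivision (`eq_augCobd_smallPrimitive`). Subtracting both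
coboundaries from `f` leaves a compactly supported primitive of `z`. -/

/-! ### Chains on augmented semi-simplicial sets with cones -/

/-- An augmented semi-simplicial set, with `S q` the simplices on `q` vertices, in which every
simplex can be coned off to every point of `V`. -/
structure ConeSystem (S : ℕ → Type*) (V : Type*) where
  face : ∀ {q : ℕ}, S (q + 1) → Fin (q + 1) → S q
  cone : ∀ {q : ℕ}, V → S q → S (q + 1)
  face_face : ∀ {q : ℕ} (s : S (q + 2)) {i j : Fin (q + 1)}, i ≤ j →
    face (face s j.succ) i = face (face s i.castSucc) j
  face_cone_zero : ∀ {q : ℕ} (v : V) (s : S q), face (cone v s) 0 = s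
  face_cone_succ : ∀ {q : ℕ} (v : V) (s : S (q + 1)) (k : Fin (q + 1)),
    face (cone v s) k.succ = cone v (face s k)

namespace ConeSystem

variable {S : ℕ → Type*} {V : Type*} (P : ConeSystem S V)

/-- The boundary of chains. -/
noncomputable def bd {q : ℕ} : (S (q + 1) →₀ ℤ) →ₗ[ℤ] (S q →₀ ℤ) :=
  Finsupp.linearCombination ℤ fun s =>
    ∑ k : Fin (q + 1), (-1 : ℤ) ^ (k : ℕ) • Finsupp.single (P.face s k) (1 : ℤ)

theorem bd_single {q : ℕ} (s : S (q + 1)) :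
    P.bd (Finsupp.single s 1) =
      ∑ k : Fin (q + 1), (-1 : ℤ) ^ (k : ℕ) • Finsupp.single (P.face s k) (1 : ℤ) := by
  simp [bd]

/-- The coboundary of cochains. -/
def cobd {q : ℕ} (c : S q → ℤ) (s : S (q + 1)) : ℤ :=
  ∑ k : Fin (q + 1), (-1 : ℤ) ^ (k : ℕ) * c (P.face s k)

/-- Evaluation of a cochain on chains. -/
noncomputable def ev {α : Type*} (c : α → ℤ) : (α →₀ ℤ) →ₗ[ℤ] ℤ := Finsupp.linearCombination ℤ c

@[simp] theorem ev_single {α : Type*} (c : α → ℤ) (s : α) :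
    ev c (Finsupp.single s 1) = c s := by
  simp [ev]

theorem ev_bd_single {q : ℕ} (c : S q → ℤ) (s : S (q + 1)) :
    ev c (P.bd (Finsupp.single s 1)) = P.cobd c s := by
  simp only [bd_single, cobd, map_sum, map_smul, ev_single, smul_eq_mul]

theorem ev_bd {q : ℕ} (c : S q → ℤ) (x : S (q + 1) →₀ ℤ) :
    ev c (P.bd x) = ev (P.cobd c) x := by
  have : (ev c).comp P.bd = ev (P.cobd c) := by
    refine Finsupp.lhom_ext' fun s => LinearMap.ext_ring ?_
    simp [ev_bd_single]
  exact LinearMap.congr_fun this x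

theorem ev_eq_zero {α : Type*} {c : α → ℤ} {W : Set α} (hc : ∀ s ∈ W, c s = 0)
    {x : α →₀ ℤ} (hx : x ∈ Finsupp.supported ℤ ℤ W) : ev c x = 0 := by
  rw [ev, Finsupp.linearCombination_apply, Finsupp.sum]
  refine Finset.sum_eq_zero fun s hs => ?_
  rw [hc s (hx hs), smul_zero]

theorem bd_bd_single {q : ℕ} (s : S (q + 2)) : P.bd (P.bd (Finsupp.single s 1)) = 0 := by
  rw [bd_single, map_sum]
  simp only [map_smul, bd_single, Finset.smul_sum, smul_smul]
  rw [← Finset.sum_product', Finset.univ_product_univ]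
  let A : Finset (Fin (q + 2) × Fin (q + 1)) := {ij | (ij.1 : ℕ) ≤ (ij.2 : ℕ)}
  rw [← Finset.sum_add_sum_compl A, ← eq_neg_iff_add_eq_zero, ← Finset.sum_neg_distrib]
  refine Finset.sum_bij'
    (fun ij hij => (ij.2.succ, ij.1.castLT (lt_of_le_of_lt (Finset.mem_filter.mp hij).2 ij.2.2)))
    (fun ij hij => (ij.2.castSucc, ij.1.pred (by
      rintro h
      simp [A, h] at hij))) ?_ ?_ ?_ ?_ ?_
  · rintro ⟨i, j⟩ hij
    simp [A] at hij ⊢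
    omega
  · rintro ⟨i, j⟩ hij
    simp [A] at hij ⊢
    omega
  · rintro ⟨i, j⟩ hij
    simp
  · rintro ⟨i, j⟩ hij
    simp
  · rintro ⟨i, j⟩ hij
    have hij' : (i : ℕ) ≤ j := by simpa [A] using hij
    have key := P.face_face s (i := i.castLT (lt_of_le_of_lt hij' j.2)) (j := j) hij'
    rw [Fin.castSucc_castLT] at key
    simp only [key, Fin.val_succ, Fin.val_castLT, pow_succ, ← neg_smul]
    congr 1
    ring

theorem bd_bd {q : ℕ} (x : S (q + 2) →₀ ℤ) : P.bd (P.bd x) = 0 := by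
  have : (P.bd (q := q)).comp P.bd = 0 :=
    Finsupp.lhom_ext' fun s => LinearMap.ext_ring (by simpa using P.bd_bd_single s)
  exact LinearMap.congr_fun this x

theorem cobd_cobd {q : ℕ} (c : S q → ℤ) : P.cobd (P.cobd c) = 0 := by
  funext s
  rw [← ev_bd_single, ← ev_bd, bd_bd, map_zero]
  rfl

/-- The linear extension of coning to chains. -/
noncomputable def coneChain {q : ℕ} (v : V) : (S q →₀ ℤ) →ₗ[ℤ] (S (q + 1) →₀ ℤ) :=
  Finsupp.lmapDomain ℤ ℤ (P.cone v)

@[simp] theorem coneChain_single {q : ℕ} (v : V) (s : S q) (a : ℤ) :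
    P.coneChain v (Finsupp.single s a) = Finsupp.single (P.cone v s) a := by
  simp [coneChain]

/-- Face zero of a cone is its base; the other faces are cones over the faces of the base, with
signs shifted by one. -/
theorem bd_coneChain {q : ℕ} (v : V) (x : S (q + 1) →₀ ℤ) :
    P.bd (P.coneChain v x) = x - P.coneChain v (P.bd x) := by
  have : P.bd.comp (P.coneChain v) = LinearMap.id - (P.coneChain v).comp (P.bd (q := q)) := by
    refine Finsupp.lhom_ext' fun s => LinearMap.ext_ring ?_
    simp [bd_single, Fin.sum_univ_succ (n := q + 1), face_cone_zero, face_cone_succ, pow_succ,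
      map_sum, sub_eq_add_neg]
  exact LinearMap.congr_fun this x

/-- A simplex without vertices has no boundary, so the correction term disappears. -/
theorem bd_coneChain_zero (v : V) (x : S 0 →₀ ℤ) : P.bd (P.coneChain v x) = x := by
  have : P.bd.comp (P.coneChain (q := 0) v) = LinearMap.id := by
    refine Finsupp.lhom_ext' fun s => LinearMap.ext_ring ?_
    simp [bd_single, face_cone_zero]
  exact LinearMap.congr_fun this x

/-! ### Subdivision with prescribed apexes -/

variable (p : ∀ {q : ℕ}, S (q + 1) → V)

/-- The chain map that replaces each simplex `s` by the cone with apex `p s` over the image of its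
boundary. For `p` the barycentre this is barycentric subdivision. -/
noncomputable def subdiv : ∀ q : ℕ, (S q →₀ ℤ) →ₗ[ℤ] (S q →₀ ℤ)
  | 0 => LinearMap.id
  | q + 1 => Finsupp.linearCombination ℤ fun s =>
      P.coneChain (p s) (subdiv q (P.bd (Finsupp.single s 1)))

/-- The chain homotopy from the identity to `subdiv`. -/
noncomputable def subdivHomotopy : ∀ q : ℕ, (S q →₀ ℤ) →ₗ[ℤ] (S (q + 1) →₀ ℤ)
  | 0 => 0
  | q + 1 => Finsupp.linearCombination ℤ fun s =>
      P.coneChain (p s) (Finsupp.single s 1 - subdivHomotopy q (P.bd (Finsupp.single s 1)))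

theorem subdiv_succ_single {q : ℕ} (s : S (q + 1)) :
    P.subdiv p (q + 1) (Finsupp.single s 1) =
      P.coneChain (p s) (P.subdiv p q (P.bd (Finsupp.single s 1))) := by
  simp [subdiv]

theorem subdivHomotopy_succ_single {q : ℕ} (s : S (q + 1)) :
    P.subdivHomotopy p (q + 1) (Finsupp.single s 1) =
      P.coneChain (p s)
        (Finsupp.single s 1 - P.subdivHomotopy p q (P.bd (Finsupp.single s 1))) := by
  simp [subdivHomotopy]

theorem bd_subdiv : ∀ {q : ℕ} (x : S (q + 1) →₀ ℤ),
    P.bd (P.subdiv p (q + 1) x) = P.subdiv p q (P.bd x) := by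
  intro q
  induction q with
  | zero =>
    intro x
    have : P.bd.comp (P.subdiv p 1) = (P.subdiv p 0).comp P.bd :=
      Finsupp.lhom_ext' fun s => LinearMap.ext_ring (by
        simp only [LinearMap.comp_apply, Finsupp.lsingle_apply, subdiv_succ_single,
          bd_coneChain_zero])
    exact LinearMap.congr_fun this x
  | succ q ih =>
    intro x
    have : P.bd.comp (P.subdiv p (q + 2)) = (P.subdiv p (q + 1)).comp P.bd :=
      Finsupp.lhom_ext' fun s => LinearMap.ext_ring (by
        simp only [LinearMap.comp_apply, Finsupp.lsingle_apply, subdiv_succ_single (q := q + 1),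
          bd_coneChain, ih, bd_bd, map_zero, sub_zero])
    exact LinearMap.congr_fun this x

/-- Write D for the homotopy and Sd for `subdiv`. By induction and ∂∂ = 0, the chain s − D∂s has
boundary Sd ∂s, so the boundary of its cone is s − D∂s minus the cone over Sd ∂s, which is Sd s. -/
theorem bd_subdivHomotopy : ∀ {q : ℕ} (x : S (q + 1) →₀ ℤ),
    P.bd (P.subdivHomotopy p (q + 1) x) =
      x - P.subdiv p (q + 1) x - P.subdivHomotopy p q (P.bd x) := by
  intro q
  induction q with
  | zero =>
    intro x
    have : P.bd.comp (P.subdivHomotopy p 1) =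
        LinearMap.id - P.subdiv p 1 - (P.subdivHomotopy p 0).comp P.bd :=
      Finsupp.lhom_ext' fun s => LinearMap.ext_ring (by
        simp only [LinearMap.comp_apply, LinearMap.sub_apply, LinearMap.id_apply,
          Finsupp.lsingle_apply, subdivHomotopy_succ_single, subdiv_succ_single, bd_coneChain]
        simp [subdivHomotopy, subdiv])
    exact LinearMap.congr_fun this x
  | succ q ih =>
    intro x
    have : P.bd.comp (P.subdivHomotopy p (q + 2)) =
        LinearMap.id - P.subdiv p (q + 2) - (P.subdivHomotopy p (q + 1)).comp P.bd :=
      Finsupp.lhom_ext' fun s => LinearMap.ext_ring (by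
        simp only [LinearMap.comp_apply, LinearMap.sub_apply, LinearMap.id_apply,
          Finsupp.lsingle_apply, subdivHomotopy_succ_single (q := q + 1),
          subdiv_succ_single (q := q + 1), bd_coneChain, map_sub, ih, bd_bd, map_zero]
        abel)
    exact LinearMap.congr_fun this x

variable {P p}

theorem bd_mem_supported {W : ∀ q, Set (S q)} (hW : ∀ {q} (s : S (q + 1)), s ∈ W (q + 1) →
    ∀ k, P.face s k ∈ W q) {q : ℕ} {s : S (q + 1)} (hs : s ∈ W (q + 1)) :
    P.bd (Finsupp.single s 1) ∈ Finsupp.supported ℤ ℤ (W q) := by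
  rw [bd_single]
  exact Submodule.sum_mem _ fun k _ => Submodule.smul_mem _ _
    (Finsupp.single_mem_supported ℤ _ (hW s hs k))

theorem map_mem_supported {α β : Type*} {A : Set α} {B : Set β}
    (L : (α →₀ ℤ) →ₗ[ℤ] (β →₀ ℤ))
    (h : ∀ a ∈ A, L (Finsupp.single a 1) ∈ Finsupp.supported ℤ ℤ B) {x : α →₀ ℤ}
    (hx : x ∈ Finsupp.supported ℤ ℤ A) : L x ∈ Finsupp.supported ℤ ℤ B := by
  rw [Finsupp.supported_eq_span_single] at hx
  refine Submodule.span_induction ?_ ?_ ?_ ?_ hx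
  · rintro _ ⟨a, ha, rfl⟩
    exact h a ha
  · simp
  · intro x y _ _ hx hy
    rw [map_add]
    exact Submodule.add_mem _ hx hy
  · intro a x _ hx
    rw [map_smul]
    exact Submodule.smul_mem _ _ hx

theorem coneChain_mem_supported {q : ℕ} {A : Set (S q)} {B : Set (S (q + 1))} {v : V}
    (h : ∀ s ∈ A, P.cone v s ∈ B) {x : S q →₀ ℤ} (hx : x ∈ Finsupp.supported ℤ ℤ A) :
    P.coneChain v x ∈ Finsupp.supported ℤ ℤ B :=
  map_mem_supported _ (fun s hs => by
    rw [coneChain_single]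
    exact Finsupp.single_mem_supported ℤ _ (h s hs)) hx

section Carrier

variable {W W' : ∀ q, Set (S q)}
  (hface : ∀ {q} (s : S (q + 1)), s ∈ W (q + 1) → ∀ k, P.face s k ∈ W q)
  (hWW' : ∀ q, W q ⊆ W' q)
  (hcone : ∀ {q} (s : S (q + 1)), s ∈ W (q + 1) → ∀ {r} (t : S r), t ∈ W' r →
    P.cone (p s) t ∈ W' (r + 1))

include hface hWW' hcone

/-- Two families are used because the apex `p s` is controlled only for `s` in `W`, while the cones
built along the way need only stay in `W'`. -/
theorem subdiv_mem_supported {q : ℕ} {x : S q →₀ ℤ} (hx : x ∈ Finsupp.supported ℤ ℤ (W q)) :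
    P.subdiv p q x ∈ Finsupp.supported ℤ ℤ (W' q) := by
  induction q with
  | zero => exact Finsupp.supported_mono (hWW' 0) hx
  | succ q ih =>
    refine map_mem_supported _ (fun s hs => ?_) hx
    rw [subdiv_succ_single]
    exact coneChain_mem_supported (fun t ht => hcone s hs t ht) (ih (bd_mem_supported hface hs))

theorem subdivHomotopy_mem_supported {q : ℕ} {x : S q →₀ ℤ}
    (hx : x ∈ Finsupp.supported ℤ ℤ (W q)) :
    P.subdivHomotopy p q x ∈ Finsupp.supported ℤ ℤ (W' (q + 1)) := by
  induction q with
  | zero => exact Submodule.zero_mem _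
  | succ q ih =>
    refine map_mem_supported _ (fun s hs => ?_) hx
    rw [subdivHomotopy_succ_single]
    exact coneChain_mem_supported (fun t ht => hcone s hs t ht) (Submodule.sub_mem _
      (Finsupp.single_mem_supported ℤ _ (hWW' _ hs)) (ih (bd_mem_supported hface hs)))

end Carrier

/-- If `p` takes finitely many values and there are finitely many simplices without vertices, then
`subdiv` takes finitely many values on simplices of each dimension. -/
theorem finite_range_subdiv [Finite (S 0)] {N : Set V} (hN : N.Finite)
    (hp : ∀ {q} (s : S (q + 1)), p s ∈ N) (q : ℕ) :
    (Set.range fun s : S q => P.subdiv p q (Finsupp.single s 1)).Finite := by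
  induction q with
  | zero => exact Set.finite_range _
  | succ q ih =>
    have : Finite (Set.range fun s : S q => P.subdiv p q (Finsupp.single s 1)) := ih
    have : Finite N := hN
    -- The value on a simplex is determined by its apex and the values on its faces.
    refine (Set.finite_range fun a : N × (Fin (q + 1) →
      Set.range fun s : S q => P.subdiv p q (Finsupp.single s 1)) =>
        P.coneChain a.1.1 (∑ k : Fin (q + 1), (-1 : ℤ) ^ (k : ℕ) • (a.2 k).1)).subset ?_
    rintro _ ⟨s, rfl⟩
    refine ⟨(⟨p s, hp s⟩, fun k => ⟨_, P.face s k, rfl⟩), ?_⟩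
    simp only [subdiv_succ_single, bd_single, map_sum, map_smul]

section Naturality

variable {S' : ℕ → Type*} {V' : Type*} {P' : ConeSystem S' V'} {p' : ∀ {q : ℕ}, S' (q + 1) → V'}
  (F : ∀ q, S q → S' q) (G : V → V')
  (hface : ∀ {q} (s : S (q + 1)) k, F q (P.face s k) = P'.face (F (q + 1) s) k)
  (hcone : ∀ {q} v (s : S q), F (q + 1) (P.cone v s) = P'.cone (G v) (F q s))
  (hp : ∀ {q} (s : S (q + 1)), G (p s) = p' (F (q + 1) s))

include hface in
theorem map_bd {q : ℕ} (x : S (q + 1) →₀ ℤ) :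
    Finsupp.lmapDomain ℤ ℤ (F q) (P.bd x) = P'.bd (Finsupp.lmapDomain ℤ ℤ (F (q + 1)) x) := by
  have : (Finsupp.lmapDomain ℤ ℤ (F q)).comp P.bd =
      P'.bd.comp (Finsupp.lmapDomain ℤ ℤ (F (q + 1))) :=
    Finsupp.lhom_ext' fun s => LinearMap.ext_ring (by
      simp [bd_single, hface, map_sum])
  exact LinearMap.congr_fun this x

include hcone in
theorem map_coneChain {q : ℕ} (v : V) (x : S q →₀ ℤ) :
    Finsupp.lmapDomain ℤ ℤ (F (q + 1)) (P.coneChain v x) =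
      P'.coneChain (G v) (Finsupp.lmapDomain ℤ ℤ (F q) x) := by
  have : (Finsupp.lmapDomain ℤ ℤ (F (q + 1))).comp (P.coneChain v) =
      (P'.coneChain (G v)).comp (Finsupp.lmapDomain ℤ ℤ (F q)) :=
    Finsupp.lhom_ext' fun s => LinearMap.ext_ring (by simp [hcone])
  exact LinearMap.congr_fun this x

include hface hcone hp

theorem map_subdiv {q : ℕ} (x : S q →₀ ℤ) :
    Finsupp.lmapDomain ℤ ℤ (F q) (P.subdiv p q x) =
      P'.subdiv p' q (Finsupp.lmapDomain ℤ ℤ (F q) x) := by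
  induction q with
  | zero => rfl
  | succ q ih =>
    have : (Finsupp.lmapDomain ℤ ℤ (F (q + 1))).comp (P.subdiv p (q + 1)) =
        (P'.subdiv p' (q + 1)).comp (Finsupp.lmapDomain ℤ ℤ (F (q + 1))) :=
      Finsupp.lhom_ext' fun s => LinearMap.ext_ring (by
        have h1 : Finsupp.lmapDomain ℤ ℤ (F (q + 1)) (Finsupp.single s 1) =
          Finsupp.single (F (q + 1) s) 1 := by simp
        simp only [LinearMap.comp_apply, Finsupp.lsingle_apply, subdiv_succ_single, h1,
          map_coneChain F G hcone, ih, map_bd F hface, hp])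
    exact LinearMap.congr_fun this x

theorem map_subdivHomotopy {q : ℕ} (x : S q →₀ ℤ) :
    Finsupp.lmapDomain ℤ ℤ (F (q + 1)) (P.subdivHomotopy p q x) =
      P'.subdivHomotopy p' q (Finsupp.lmapDomain ℤ ℤ (F q) x) := by
  induction q with
  | zero => simp [subdivHomotopy]
  | succ q ih =>
    have : (Finsupp.lmapDomain ℤ ℤ (F (q + 2))).comp (P.subdivHomotopy p (q + 1)) =
        (P'.subdivHomotopy p' (q + 1)).comp (Finsupp.lmapDomain ℤ ℤ (F (q + 1))) :=
      Finsupp.lhom_ext' fun s => LinearMap.ext_ring (by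
        have h1 : Finsupp.lmapDomain ℤ ℤ (F (q + 1)) (Finsupp.single s 1) =
          Finsupp.single (F (q + 1) s) 1 := by simp
        simp only [LinearMap.comp_apply, Finsupp.lsingle_apply, subdivHomotopy_succ_single, h1,
          map_coneChain F G hcone, map_sub, ih, map_bd F hface, hp])
    exact LinearMap.congr_fun this x

end Naturality

end ConeSystem

/-! ### Affine simplices and the theorem of small simplices -/

/-- Singular simplices on `q` vertices; for `q = 0` there is exactly one. -/
abbrev AugSimplex (X : Type*) [TopologicalSpace X] (q : ℕ) : Type _ :=
  C(stdSimplex ℝ (Fin q), X)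

/-- The face of a singular simplex opposite to the `k`-th vertex. -/
noncomputable def AugSimplex.face {X : Type*} [TopologicalSpace X] {q : ℕ}
    (σ : AugSimplex X (q + 1)) (k : Fin (q + 1)) : AugSimplex X q :=
  σ.comp ⟨stdSimplex.map k.succAbove, stdSimplex.continuous_map k.succAbove⟩

/-- The coboundary on augmented singular cochains. -/
noncomputable def augCobd {X : Type*} [TopologicalSpace X] {q : ℕ} (c : AugSimplex X q → ℤ)
    (σ : AugSimplex X (q + 1)) : ℤ :=
  ∑ k : Fin (q + 1), (-1 : ℤ) ^ (k : ℕ) * c (σ.face k)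

theorem succAbove_comp_succAbove {q : ℕ} {i j : Fin (q + 1)} (h : i ≤ j) :
    j.succ.succAbove ∘ i.succAbove = i.castSucc.succAbove ∘ j.succAbove := by
  funext k
  simp only [Function.comp, Fin.succAbove, Fin.lt_def, Fin.le_def, Fin.ext_iff] at *
  split_ifs <;> simp_all <;> omega

theorem AugSimplex.face_face {X : Type*} [TopologicalSpace X] {q : ℕ}
    (σ : AugSimplex X (q + 2)) {i j : Fin (q + 1)} (h : i ≤ j) :
    (σ.face j.succ).face i = (σ.face i.castSucc).face j := by
  ext x
  simp only [AugSimplex.face, ContinuousMap.comp_apply, ContinuousMap.coe_mk,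
    stdSimplex.map_comp_apply]
  congr 2
  exact succAbove_comp_succAbove h

theorem AugSimplex.face_apply {X : Type*} [TopologicalSpace X] {q : ℕ}
    (σ : AugSimplex X (q + 1)) (k : Fin (q + 1)) (x : stdSimplex ℝ (Fin q)) :
    σ.face k x = σ (stdSimplex.map k.succAbove x) := rfl

/-- Tuples of points of `Y`, with cones given by prepending a point. -/
def tupleSystem (Y : Type*) : ConeSystem (fun q => Fin q → Y) Y where
  face w k := w ∘ k.succAbove
  cone v w := Fin.cons v w
  face_face w i j h := by
    simp only [Function.comp_assoc, succAbove_comp_succAbove h]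
  face_cone_zero v w := by
    funext k
    simp
  face_cone_succ v w k := by
    funext l
    refine Fin.cases ?_ (fun l => ?_) l <;> simp

/-- The affine simplex with given vertices in a standard simplex. -/
noncomputable def affineSimplex {m q : ℕ} (w : Fin q → stdSimplex ℝ (Fin m)) :
    C(stdSimplex ℝ (Fin q), stdSimplex ℝ (Fin m)) where
  toFun x := ⟨∑ k, x k • (w k).1, (convex_stdSimplex ℝ (Fin m)).sum_mem
    (fun k _ => x.2.1 k) x.2.2 fun k _ => (w k).2⟩
  continuous_toFun := by
    refine Continuous.subtype_mk (continuous_finsetSum _ fun k _ => ?_) _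
    exact ((continuous_apply k).comp continuous_subtype_val).smul continuous_const

theorem coe_affineSimplex {m q : ℕ} (w : Fin q → stdSimplex ℝ (Fin m))
    (x : stdSimplex ℝ (Fin q)) :
    (affineSimplex w x).1 = ∑ k, x k • (w k).1 := rfl

theorem affineSimplex_mem {m q : ℕ} {C : Set (Fin m → ℝ)} (hC : Convex ℝ C)
    {w : Fin q → stdSimplex ℝ (Fin m)} (hw : ∀ k, (w k).1 ∈ C)
    (x : stdSimplex ℝ (Fin q)) : (affineSimplex w x).1 ∈ C :=
  hC.sum_mem (fun k _ => x.2.1 k) x.2.2 fun k _ => hw k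

theorem affineSimplex_map {m q r : ℕ} (w : Fin r → stdSimplex ℝ (Fin m)) (g : Fin q → Fin r)
    (x : stdSimplex ℝ (Fin q)) :
    affineSimplex w (stdSimplex.map g x) = affineSimplex (w ∘ g) x := by
  apply Subtype.ext
  rw [coe_affineSimplex, coe_affineSimplex]
  simp only [stdSimplex.map_coe, FunOnFinite.linearMap_apply_apply, Finset.sum_smul]
  rw [← Finset.sum_fiberwise (s := Finset.univ) (g := g)]
  refine Finset.sum_congr rfl fun k _ => Finset.sum_congr rfl fun i hi => ?_
  rw [Function.comp_apply, (Finset.mem_filter.mp hi).2]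

theorem map_affineSimplex {m m' q : ℕ} (w : Fin q → stdSimplex ℝ (Fin m)) (g : Fin m → Fin m')
    (x : stdSimplex ℝ (Fin q)) :
    stdSimplex.map g (affineSimplex w x) = affineSimplex (fun k => stdSimplex.map g (w k)) x := by
  apply Subtype.ext
  change FunOnFinite.linearMap ℝ ℝ g (∑ k, x k • (w k).1) =
    ∑ k, x k • FunOnFinite.linearMap ℝ ℝ g (w k).1
  simp only [map_sum, map_smul]

theorem affineSimplex_vertex {m : ℕ} (x : stdSimplex ℝ (Fin m)) :
    affineSimplex (fun k : Fin m => stdSimplex.vertex k) x = x := by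
  apply Subtype.ext
  rw [coe_affineSimplex]
  funext i
  simp [Finset.sum_apply, Pi.single_apply]
  rfl

/-- The barycentre of a tuple of points of a standard simplex. -/
noncomputable def tupleBarycenter {m q : ℕ} (w : Fin (q + 1) → stdSimplex ℝ (Fin m)) :
    stdSimplex ℝ (Fin m) :=
  affineSimplex w stdSimplex.barycenter

/-- The difference is the average of the q + 1 vectors `w k - w j`, one of which is zero. -/
theorem dist_tupleBarycenter_le {m q : ℕ} (w : Fin (q + 1) → stdSimplex ℝ (Fin m)) {d : ℝ}
    (hd : ∀ k l, dist (w k) (w l) ≤ d) (j : Fin (q + 1)) :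
    dist (tupleBarycenter w) (w j) ≤ (1 - 1 / (q + 1 : ℝ)) * d := by
  have hq : (0 : ℝ) < q + 1 := by positivity
  have hb : (tupleBarycenter w).1 - (w j).1 =
      ∑ k, (1 / (q + 1 : ℝ)) • ((w k).1 - (w j).1) := by
    rw [tupleBarycenter, coe_affineSimplex]
    have h : ∀ k, (stdSimplex.barycenter : stdSimplex ℝ (Fin (q + 1))) k = 1 / (q + 1 : ℝ) := by
      intro k
      change ((Fintype.card (Fin (q + 1)) : ℝ))⁻¹ = _
      simp
    simp only [h, smul_sub, Finset.sum_sub_distrib, Finset.sum_const, Finset.card_univ,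
      Fintype.card_fin, ← Nat.cast_smul_eq_nsmul ℝ, smul_smul]
    push_cast
    rw [mul_one_div_cancel hq.ne', one_smul]
  rw [Subtype.dist_eq, dist_eq_norm, hb]
  refine (norm_sum_le _ _).trans ?_
  rw [← Finset.add_sum_erase _ _ (Finset.mem_univ j)]
  have : ∀ k ∈ Finset.univ.erase j,
      ‖(1 / (q + 1 : ℝ)) • ((w k).1 - (w j).1)‖ ≤ 1 / (q + 1 : ℝ) * d := by
    intro k _
    rw [norm_smul, Real.norm_of_nonneg (by positivity), ← dist_eq_norm, ← Subtype.dist_eq]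
    exact mul_le_mul_of_nonneg_left (hd k j) (by positivity)
  refine (add_le_add_right (Finset.sum_le_card_nsmul _ _ _ this) _).trans (le_of_eq ?_)
  simp [Finset.card_erase_of_mem]
  field_simp
  ring

/-! ### Barycentric subdivision in standard simplices -/

section Subdivision

open ConeSystem

variable {m : ℕ}

/-- Barycentric subdivision of affine chains in a standard simplex. -/
noncomputable abbrev affSubdiv (m q : ℕ) :
    ((Fin q → stdSimplex ℝ (Fin m)) →₀ ℤ) →ₗ[ℤ] ((Fin q → stdSimplex ℝ (Fin m)) →₀ ℤ) :=
  (tupleSystem (stdSimplex ℝ (Fin m))).subdiv tupleBarycenter q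

/-- The chain homotopy from the identity to barycentric subdivision. -/
noncomputable abbrev affHomotopy (m q : ℕ) :
    ((Fin q → stdSimplex ℝ (Fin m)) →₀ ℤ) →ₗ[ℤ] ((Fin (q + 1) → stdSimplex ℝ (Fin m)) →₀ ℤ) :=
  (tupleSystem (stdSimplex ℝ (Fin m))).subdivHomotopy tupleBarycenter q

theorem affSubdiv_mem_supported {C : Set (Fin m → ℝ)} (hC : Convex ℝ C) {q : ℕ}
    {x : (Fin q → stdSimplex ℝ (Fin m)) →₀ ℤ}
    (hx : x ∈ Finsupp.supported ℤ ℤ {w | ∀ k, (w k).1 ∈ C}) :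
    affSubdiv m q x ∈ Finsupp.supported ℤ ℤ {w | ∀ k, (w k).1 ∈ C} :=
  subdiv_mem_supported (W := fun q => {w : Fin q → stdSimplex ℝ (Fin m) | ∀ k, (w k).1 ∈ C})
    (W' := fun q => {w : Fin q → stdSimplex ℝ (Fin m) | ∀ k, (w k).1 ∈ C})
    (fun _ hw _ _ => hw _) (fun _ => subset_rfl)
    (fun _ hw _ _ ht k => Fin.cases (affineSimplex_mem hC hw _) ht k) hx

theorem affHomotopy_mem_supported {C : Set (Fin m → ℝ)} (hC : Convex ℝ C) {q : ℕ}
    {x : (Fin q → stdSimplex ℝ (Fin m)) →₀ ℤ}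
    (hx : x ∈ Finsupp.supported ℤ ℤ {w | ∀ k, (w k).1 ∈ C}) :
    affHomotopy m q x ∈ Finsupp.supported ℤ ℤ {w | ∀ k, (w k).1 ∈ C} :=
  subdivHomotopy_mem_supported
    (W := fun q => {w : Fin q → stdSimplex ℝ (Fin m) | ∀ k, (w k).1 ∈ C})
    (W' := fun q => {w : Fin q → stdSimplex ℝ (Fin m) | ∀ k, (w k).1 ∈ C})
    (fun _ hw _ _ => hw _) (fun _ => subset_rfl)
    (fun _ hw _ _ ht k => Fin.cases (affineSimplex_mem hC hw _) ht k) hx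

/-- Barycentric subdivision shrinks simplices by a factor depending on the dimension only. -/
theorem affSubdiv_mesh (M : ℕ) {d : ℝ} (hd : 0 ≤ d) {q : ℕ} (hq : q ≤ M)
    {x : (Fin q → stdSimplex ℝ (Fin m)) →₀ ℤ}
    (hx : x ∈ Finsupp.supported ℤ ℤ {w | ∀ k l, dist (w k) (w l) ≤ d}) :
    affSubdiv m q x ∈ Finsupp.supported ℤ ℤ {w | ∀ k l, dist (w k) (w l) ≤ (1 - 1 / M) * d} := by
  induction q with
  | zero =>
    rw [show {w : Fin 0 → stdSimplex ℝ (Fin m) | ∀ k l, dist (w k) (w l) ≤ (1 - 1 / M) * d} =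
      Set.univ from Set.eq_univ_of_forall fun w k => k.elim0]
    simp
  | succ q ih =>
    refine map_mem_supported _ (fun w hw => ?_) hx
    rw [subdiv_succ_single]
    have hr : (1 - 1 / (q + 1 : ℝ)) * d ≤ (1 - 1 / M) * d := by
      refine mul_le_mul_of_nonneg_right ?_ hd
      refine sub_le_sub_left ?_ _
      refine one_div_le_one_div_of_le (by positivity) ?_
      exact_mod_cast hq
    have h1 := ih (by omega) (bd_mem_supported (P := tupleSystem (stdSimplex ℝ (Fin m)))
      (W := fun q => {w : Fin q → stdSimplex ℝ (Fin m) | ∀ k l, dist (w k) (w l) ≤ d})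
      (fun w hw k l l' => hw _ _) hw)
    -- `h1` bounds the edges inside the subdivided boundary. For edges at the apex, a ball around
    -- the barycentre contains the vertices of `w`, hence by convexity the subdivided boundary.
    have h2 := affSubdiv_mem_supported
      (convex_closedBall (tupleBarycenter w).1 ((1 - 1 / M) * d))
      (bd_mem_supported (P := tupleSystem (stdSimplex ℝ (Fin m)))
      (W := fun q => {u : Fin q → stdSimplex ℝ (Fin m) |
        ∀ k, (u k).1 ∈ Metric.closedBall (tupleBarycenter w).1 ((1 - 1 / M) * d)})
      (fun w hw k l => hw _) (s := w) (fun k => by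
        rw [Metric.mem_closedBall, dist_comm]
        exact (dist_tupleBarycenter_le w hw k).trans hr))
    have h3 := Finsupp.supported_inter (M := ℤ) (R := ℤ) _ _ ▸ Submodule.mem_inf.mpr ⟨h1, h2⟩
    refine coneChain_mem_supported ?_ h3
    rintro t ⟨ht1, ht2⟩ k l
    have hnn : 0 ≤ (1 - 1 / (M : ℝ)) * d := by
      refine mul_nonneg ?_ hd
      rw [sub_nonneg, div_le_one (by exact_mod_cast (by omega : 0 < M))]
      exact_mod_cast (by omega : 1 ≤ M)
    have ht3 : ∀ k, dist (tupleBarycenter w) (t k) ≤ (1 - 1 / (M : ℝ)) * d := by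
      intro k
      have := ht2 k
      rwa [Metric.mem_closedBall, dist_comm, ← Subtype.dist_eq] at this
    refine Fin.cases ?_ (fun k => ?_) k <;> refine Fin.cases ?_ (fun l => ?_) l
    · simpa [tupleSystem] using hnn
    · simpa [tupleSystem] using ht3 l
    · simpa [tupleSystem, dist_comm] using ht3 k
    · simpa [tupleSystem] using ht1 k l

theorem affSubdiv_iterate_mesh (M j : ℕ) (hM : 1 ≤ M) {q : ℕ} (hq : q ≤ M)
    {x : (Fin q → stdSimplex ℝ (Fin m)) →₀ ℤ} :
    ((affSubdiv m q)^[j] x) ∈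
      Finsupp.supported ℤ ℤ {w | ∀ k l, dist (w k) (w l) ≤ (1 - 1 / (M : ℝ)) ^ j} := by
  induction j with
  | zero =>
    rw [show {w : Fin q → stdSimplex ℝ (Fin m) | ∀ k l, dist (w k) (w l) ≤
      (1 - 1 / (M : ℝ)) ^ 0} = Set.univ from Set.eq_univ_of_forall fun w k l => ?_]
    · simp
    · rw [pow_zero]
      exact (Metric.dist_le_diam_of_mem (bounded_stdSimplex (Fin m)) (w k).2 (w l).2).trans
        (diam_stdSimplex_le)
  | succ j ih =>
    rw [Function.iterate_succ_apply', pow_succ']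
    refine affSubdiv_mesh M (pow_nonneg ?_ _) hq ih
    rw [sub_nonneg, div_le_one (by exact_mod_cast hM)]
    exact_mod_cast hM

/-- The homotopy stays in every convex set that contains the simplex, such as the ball of radius `d`
around its zeroth vertex. -/
theorem affHomotopy_mesh {d : ℝ} {q : ℕ} {x : (Fin q → stdSimplex ℝ (Fin m)) →₀ ℤ}
    (hx : x ∈ Finsupp.supported ℤ ℤ {w | ∀ k l, dist (w k) (w l) ≤ d}) :
    affHomotopy m q x ∈ Finsupp.supported ℤ ℤ
      {w | ∃ c : Fin m → ℝ, ∀ k, (w k).1 ∈ Metric.closedBall c d} := by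
  cases q with
  | zero => exact Submodule.zero_mem _
  | succ q =>
    refine map_mem_supported _ (fun w hw => ?_) hx
    have h := affHomotopy_mem_supported (convex_closedBall (w 0).1 d)
      (Finsupp.single_mem_supported ℤ (1 : ℤ) (a := w) (fun k => hw k 0))
    refine Finsupp.supported_mono (fun u hu => ?_) h
    exact ⟨(w 0).1, hu⟩

theorem bd_affSubdiv_iterate (j : ℕ) {q : ℕ} (x : (Fin (q + 1) → stdSimplex ℝ (Fin m)) →₀ ℤ) :
    (tupleSystem _).bd ((affSubdiv m (q + 1))^[j] x) =
      (affSubdiv m q)^[j] ((tupleSystem _).bd x) := by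
  induction j with
  | zero => rfl
  | succ j ih => rw [Function.iterate_succ_apply', Function.iterate_succ_apply', bd_subdiv, ih]

/-- Pushing an affine chain forward to a larger standard simplex. -/
noncomputable abbrev affMap {m m' : ℕ} (g : Fin m → Fin m') (q : ℕ) :
    ((Fin q → stdSimplex ℝ (Fin m)) →₀ ℤ) →ₗ[ℤ] ((Fin q → stdSimplex ℝ (Fin m')) →₀ ℤ) :=
  Finsupp.lmapDomain ℤ ℤ fun w k => stdSimplex.map g (w k)

theorem affMap_affSubdiv {m' : ℕ} (g : Fin m → Fin m') {q : ℕ}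
    (x : (Fin q → stdSimplex ℝ (Fin m)) →₀ ℤ) :
    affMap g q (affSubdiv m q x) = affSubdiv m' q (affMap g q x) :=
  map_subdiv (P := tupleSystem _) (P' := tupleSystem _)
    (fun q (w : Fin q → stdSimplex ℝ (Fin m)) k => stdSimplex.map g (w k)) (stdSimplex.map g)
    (fun _ _ => rfl)
    (fun v w => by
      funext k
      refine Fin.cases ?_ (fun l => ?_) k <;> simp [tupleSystem])
    (fun w => map_affineSimplex w g _) x

theorem affMap_affHomotopy {m' : ℕ} (g : Fin m → Fin m') {q : ℕ}
    (x : (Fin q → stdSimplex ℝ (Fin m)) →₀ ℤ) :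
    affMap g (q + 1) (affHomotopy m q x) = affHomotopy m' q (affMap g q x) :=
  map_subdivHomotopy (P := tupleSystem _) (P' := tupleSystem _)
    (fun q (w : Fin q → stdSimplex ℝ (Fin m)) k => stdSimplex.map g (w k)) (stdSimplex.map g)
    (fun _ _ => rfl)
    (fun v w => by
      funext k
      refine Fin.cases ?_ (fun l => ?_) k <;> simp [tupleSystem])
    (fun w => map_affineSimplex w g _) x

theorem affMap_affSubdiv_iterate {m' : ℕ} (g : Fin m → Fin m') (j : ℕ) {q : ℕ}
    (x : (Fin q → stdSimplex ℝ (Fin m)) →₀ ℤ) :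
    affMap g q ((affSubdiv m q)^[j] x) = (affSubdiv m' q)^[j] (affMap g q x) := by
  induction j with
  | zero => rfl
  | succ j ih =>
    rw [Function.iterate_succ_apply', Function.iterate_succ_apply', affMap_affSubdiv, ih]

end Subdivision

/-! ### Cocycles that vanish on small simplices -/

section SmallSimplices

open ConeSystem

variable {X : Type*} [MetricSpace X]

/-- The pullback of a singular cochain to affine simplices, along a singular simplex. -/
noncomputable def pullAff {m q : ℕ} (f : AugSimplex X q → ℤ) (σ : AugSimplex X m)
    (w : Fin q → stdSimplex ℝ (Fin m)) : ℤ :=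
  f (σ.comp (affineSimplex w))

theorem cobd_pullAff {m q : ℕ} (f : AugSimplex X q → ℤ) (σ : AugSimplex X m) :
    (tupleSystem _).cobd (pullAff f σ) = pullAff (augCobd f) σ := by
  funext w
  refine Finset.sum_congr rfl fun k _ => ?_
  refine congrArg (fun τ => (-1 : ℤ) ^ (k : ℕ) * f τ) ?_
  ext x
  exact congrArg σ (affineSimplex_map w k.succAbove x).symm

theorem ev_pullAff_face {m q : ℕ} (f : AugSimplex X q → ℤ) (σ : AugSimplex X (m + 1))
    (k : Fin (m + 1)) (x : (Fin q → stdSimplex ℝ (Fin m)) →₀ ℤ) :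
    ev (pullAff f (σ.face k)) x = ev (pullAff f σ) (affMap k.succAbove q x) := by
  have : ev (pullAff f (σ.face k)) = (ev (pullAff f σ)).comp (affMap k.succAbove q) := by
    refine Finsupp.lhom_ext' fun w => LinearMap.ext_ring ?_
    simp only [LinearMap.comp_apply, Finsupp.lsingle_apply, ev_single, affMap,
      Finsupp.lmapDomain_apply, Finsupp.mapDomain_single]
    refine congrArg f ?_
    ext x
    exact congrArg σ (map_affineSimplex w k.succAbove x)
  exact LinearMap.congr_fun this x

/-- The vertices of a standard simplex, as an affine chain. -/
noncomputable def vertexChain (m : ℕ) : (Fin m → stdSimplex ℝ (Fin m)) →₀ ℤ :=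
  Finsupp.single (fun k => stdSimplex.vertex k) 1

theorem bd_vertexChain (m : ℕ) : (tupleSystem _).bd (vertexChain (m + 1)) =
    ∑ k : Fin (m + 1), (-1 : ℤ) ^ (k : ℕ) • affMap k.succAbove m (vertexChain m) := by
  rw [vertexChain, bd_single]
  refine Finset.sum_congr rfl fun k _ => ?_
  congr 1
  simp only [vertexChain, affMap, Finsupp.lmapDomain_apply, Finsupp.mapDomain_single]
  congr 1
  funext l
  simp [tupleSystem]

theorem ev_pullAff_vertexChain {m : ℕ} (f : AugSimplex X m → ℤ) (σ : AugSimplex X m) :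
    ev (pullAff f σ) (vertexChain m) = f σ := by
  rw [vertexChain, ev_single, pullAff]
  congr 1
  ext x
  exact congrArg σ (affineSimplex_vertex x)

/-- A cochain that vanishes on small simplices vanishes on sufficiently small affine pieces of any
given simplex. -/
theorem exists_pullAff_eq_zero {m q : ℕ} (f : AugSimplex X q → ℤ) {U : Set X}
    (hsmall : ∀ τ : AugSimplex X q, (∀ x, τ x ∈ U) → (∀ x y, dist (τ x) (τ y) ≤ 1) → f τ = 0)
    (σ : AugSimplex X m) (hσ : ∀ x, σ x ∈ U) :
    ∃ δ > 0, ∀ w : Fin q → stdSimplex ℝ (Fin m),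
      (∃ c : Fin m → ℝ, ∀ k, (w k).1 ∈ Metric.closedBall c δ) → pullAff f σ w = 0 := by
  obtain ⟨δ, hδ, h⟩ := Metric.uniformContinuous_iff.mp
    (CompactSpace.uniformContinuous_of_continuous σ.continuous) 1 one_pos
  -- The affine simplex stays in a convex ball of radius `δ / 3`, so its points are less than `δ`
  -- apart.
  refine ⟨δ / 3, by positivity, ?_⟩
  rintro w ⟨c, hc⟩
  refine hsmall _ (fun x => hσ _) fun x y => (h ?_).le
  have h1 := affineSimplex_mem (convex_closedBall c (δ / 3)) hc x
  have h2 := affineSimplex_mem (convex_closedBall c (δ / 3)) hc y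
  have h3 := dist_triangle_right (affineSimplex w x).1 (affineSimplex w y).1 c
  rw [Metric.mem_closedBall] at h1 h2
  rw [Subtype.dist_eq]
  linarith

/-- The denominator is `q + 1` because for `q = 0` the factor with denominator `q` would be 1 and
would not decay. -/
theorem exists_pow_mesh_le (q : ℕ) {δ : ℝ} (hδ : 0 < δ) :
    ∃ J : ℕ, ∀ j ≥ J, (1 - 1 / ((q + 1 : ℕ) : ℝ)) ^ j ≤ δ := by
  have h0 : (0 : ℝ) ≤ 1 - 1 / ((q + 1 : ℕ) : ℝ) := by
    rw [sub_nonneg, div_le_one (by positivity)]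
    exact_mod_cast Nat.le_add_left 1 q
  have h1 : 1 - 1 / ((q + 1 : ℕ) : ℝ) < 1 := by
    rw [sub_lt_self_iff]
    positivity
  obtain ⟨J, hJ⟩ := exists_pow_lt_of_lt_one hδ h1
  exact ⟨J, fun j hj => (pow_le_pow_of_le_one h0 h1.le hj).trans hJ.le⟩

theorem exists_ev_subdiv_eq_zero {m q : ℕ} (f : AugSimplex X q → ℤ) {U : Set X}
    (hsmall : ∀ τ : AugSimplex X q, (∀ x, τ x ∈ U) → (∀ x y, dist (τ x) (τ y) ≤ 1) → f τ = 0)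
    (σ : AugSimplex X m) (hσ : ∀ x, σ x ∈ U) :
    ∃ J : ℕ, ∀ j ≥ J, ∀ x, ev (pullAff f σ) ((affSubdiv m q)^[j] x) = 0 := by
  obtain ⟨δ, hδ, h⟩ := exists_pullAff_eq_zero f hsmall σ hσ
  obtain ⟨J, hJ⟩ := exists_pow_mesh_le q hδ
  refine ⟨J, fun j hj x => ev_eq_zero (fun w hw => ?_)
    (affSubdiv_iterate_mesh (q + 1) j (by omega) (by omega))⟩
  cases q with
  | zero => exact h w ⟨0, fun k => k.elim0⟩
  | succ q => exact h w ⟨(w 0).1, fun k => (hw k 0).trans (hJ j hj)⟩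

theorem exists_ev_homotopy_eq_zero {m q : ℕ} (f : AugSimplex X (q + 1) → ℤ) {U : Set X}
    (hsmall : ∀ τ : AugSimplex X (q + 1),
      (∀ x, τ x ∈ U) → (∀ x y, dist (τ x) (τ y) ≤ 1) → f τ = 0)
    (σ : AugSimplex X m) (hσ : ∀ x, σ x ∈ U) :
    ∃ J : ℕ, ∀ j ≥ J, ∀ x, ev (pullAff f σ) (affHomotopy m q ((affSubdiv m q)^[j] x)) = 0 := by
  obtain ⟨δ, hδ, h⟩ := exists_pullAff_eq_zero f hsmall σ hσ
  obtain ⟨J, hJ⟩ := exists_pow_mesh_le q hδ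
  refine ⟨J, fun j hj x => ev_eq_zero (fun w hw => ?_) (affHomotopy_mesh
    (affSubdiv_iterate_mesh (q + 1) j (by omega) (by omega)))⟩
  obtain ⟨c, hc⟩ := hw
  exact h w ⟨c, fun k => Metric.closedBall_subset_closedBall (hJ j hj) (hc k)⟩

/-- The primitive, given by iterated subdivision, of a cocycle that vanishes on small simplices. -/
noncomputable def smallPrimitive {q : ℕ} (f : AugSimplex X (q + 1) → ℤ) (τ : AugSimplex X q) : ℤ :=
  ∑ᶠ j : ℕ, ev (pullAff f τ) (affHomotopy q q ((affSubdiv q q)^[j] (vertexChain q)))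

theorem smallPrimitive_eq_sum {q : ℕ} (f : AugSimplex X (q + 1) → ℤ) (τ : AugSimplex X q) {J : ℕ}
    (hJ : ∀ j ≥ J, ∀ x, ev (pullAff f τ) (affHomotopy q q ((affSubdiv q q)^[j] x)) = 0) :
    smallPrimitive f τ = ∑ j ∈ Finset.range J,
      ev (pullAff f τ) (affHomotopy q q ((affSubdiv q q)^[j] (vertexChain q))) := by
  refine finsum_eq_sum_of_support_subset _ fun j hj => ?_
  rw [Finset.coe_range, Set.mem_Iio]
  by_contra! h
  exact hj (hJ j h _)

/-- A cocycle that vanishes on small simplices is a coboundary. -/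
theorem eq_augCobd_smallPrimitive {q : ℕ} (f : AugSimplex X (q + 1) → ℤ) {U : Set X}
    (hsmall : ∀ τ : AugSimplex X (q + 1),
      (∀ x, τ x ∈ U) → (∀ x y, dist (τ x) (τ y) ≤ 1) → f τ = 0)
    (hf : ∀ τ : AugSimplex X (q + 2), (∀ x, τ x ∈ U) → augCobd f τ = 0)
    (σ : AugSimplex X (q + 1)) (hσ : ∀ x, σ x ∈ U) : f σ = augCobd (smallPrimitive f) σ := by
  obtain ⟨J₀, hJ₀⟩ := exists_ev_subdiv_eq_zero f hsmall σ hσ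
  choose J hJ using fun k : Fin (q + 1) =>
    exists_ev_homotopy_eq_zero f hsmall (σ.face k) fun x => hσ _
  -- From stage `L` on, `f` vanishes on the subdivisions of `σ`, and the sums defining the primitive
  -- on all faces of `σ` have no further terms.
  let L := J₀ + ∑ k, J k
  have hL : ∀ k, J k ≤ L := fun k =>
    (Finset.single_le_sum (fun _ _ => Nat.zero_le _) (Finset.mem_univ k)).trans
      (Nat.le_add_left _ _)
  -- The homotopy formula, in which the boundary term drops out since `f` is a cocycle on simplices
  -- in `U`. The sum over `j` then telescopes.
  have hstep : ∀ j, ev (pullAff f σ) (affHomotopy (q + 1) q ((affSubdiv (q + 1) q)^[j]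
      ((tupleSystem _).bd (vertexChain (q + 1))))) =
      ev (pullAff f σ) ((affSubdiv (q + 1) (q + 1))^[j] (vertexChain (q + 1))) -
      ev (pullAff f σ) ((affSubdiv (q + 1) (q + 1))^[j + 1] (vertexChain (q + 1))) := by
    intro j
    set y := (affSubdiv (q + 1) (q + 1))^[j] (vertexChain (q + 1)) with hy
    have h1 := congrArg (ev (pullAff f σ)) (bd_subdivHomotopy
      (P := tupleSystem (stdSimplex ℝ (Fin (q + 1)))) (p := tupleBarycenter) y)
    have h2 := ev_bd (tupleSystem (stdSimplex ℝ (Fin (q + 1)))) (pullAff f σ)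
      (affHomotopy (q + 1) (q + 1) y)
    rw [cobd_pullAff, ev_eq_zero (c := pullAff (augCobd f) σ) (W := Set.univ)
      (fun w _ => hf (σ.comp (affineSimplex w)) fun x => hσ _) (by simp)] at h2
    replace h1 := h2.symm.trans h1
    rw [← bd_affSubdiv_iterate, Function.iterate_succ_apply', ← hy]
    simp only [map_sub] at h1
    linarith
  calc f σ = ev (pullAff f σ) (vertexChain (q + 1)) := (ev_pullAff_vertexChain f σ).symm
    _ = ∑ j ∈ Finset.range L, ev (pullAff f σ) (affHomotopy (q + 1) q ((affSubdiv (q + 1) q)^[j]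
      ((tupleSystem _).bd (vertexChain (q + 1))))) := by
        rw [Finset.sum_congr rfl fun j _ => hstep j, Finset.sum_range_sub', hJ₀ L (by omega),
          sub_zero]
        rfl
    _ = ∑ j ∈ Finset.range L, ∑ k : Fin (q + 1), (-1 : ℤ) ^ (k : ℕ) *
          ev (pullAff f (σ.face k)) (affHomotopy q q ((affSubdiv q q)^[j] (vertexChain q))) := by
        refine Finset.sum_congr rfl fun j _ => ?_
        -- As a power of an endomorphism the iterate passes through the alternating sum over faces;
        -- naturality then moves each term into the standard simplex of the face.
        have hiter : ∀ x, (affSubdiv (q + 1) q)^[j] x = ((affSubdiv (q + 1) q) ^ j) x := fun x =>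
          (Module.End.pow_apply _ _ _).symm
        rw [bd_vertexChain, hiter]
        simp only [map_sum, map_smul, smul_eq_mul]
        simp only [← hiter, ← affMap_affSubdiv_iterate, ← affMap_affHomotopy, ev_pullAff_face]
    _ = augCobd (smallPrimitive f) σ := by
        rw [Finset.sum_comm]
        refine Finset.sum_congr rfl fun k _ => ?_
        rw [smallPrimitive_eq_sum f (σ.face k) fun j hj => hJ k j ((hL k).trans hj),
          Finset.mul_sum]

end SmallSimplices

/-! ### Cones in CAT(0) spaces -/

/-- The law of cosines gives the first coordinate u of the third vertex. Both 2a(b + u) = (a + b)² −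
c² and 2a(b − u) = c² − (a − b)² are nonnegative by the triangle inequalities, so |u| ≤ b. -/
theorem exists_comparison_triangle {a b c : ℝ} (ha : 0 ≤ a) (hb : 0 ≤ b) (hab : c ≤ a + b)
    (hac : a ≤ c + b) (hbc : b ≤ a + c) :
    ∃ x y z : EuclideanSpace ℝ (Fin 2), dist x y = a ∧ dist y z = c ∧ dist x z = b := by
  rcases ha.eq_or_lt with rfl | ha
  · obtain rfl : b = c := by linarith
    refine ⟨!₂[0, 0], !₂[0, 0], !₂[b, 0], ?_, ?_, ?_⟩ <;>
      simp [EuclideanSpace.dist_eq, Fin.sum_univ_two, Real.sqrt_sq_eq_abs, abs_of_nonneg hb]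
  · set u := (a ^ 2 + b ^ 2 - c ^ 2) / (2 * a) with hu
    have hua : 2 * a * u = a ^ 2 + b ^ 2 - c ^ 2 := by
      rw [hu]
      field_simp
    have hc : 0 ≤ c := by linarith
    have hub : u ^ 2 ≤ b ^ 2 := by
      refine sq_le_sq' ?_ ?_
      · have : 0 ≤ 2 * a * (u + b) := by nlinarith
        nlinarith [(mul_nonneg_iff_of_pos_left (by positivity : 0 < 2 * a)).mp this]
      · have : 0 ≤ 2 * a * (b - u) := by nlinarith
        nlinarith [(mul_nonneg_iff_of_pos_left (by positivity : 0 < 2 * a)).mp this]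
    have hv := Real.sq_sqrt (sub_nonneg.mpr hub)
    refine ⟨!₂[0, 0], !₂[a, 0], !₂[u, Real.sqrt (b ^ 2 - u ^ 2)], ?_, ?_, ?_⟩
    · simp [EuclideanSpace.dist_eq, Fin.sum_univ_two, Real.sqrt_sq_eq_abs, abs_of_pos ha]
    · rw [EuclideanSpace.dist_eq, Real.sqrt_eq_iff_eq_sq (by positivity) hc]
      simp only [Fin.sum_univ_two, Real.dist_eq, sq_abs, Matrix.cons_val_zero,
        Matrix.cons_val_one]
      nlinarith
    · rw [EuclideanSpace.dist_eq, Real.sqrt_eq_iff_eq_sq (by positivity) hb]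
      simp only [Fin.sum_univ_two, Real.dist_eq, sq_abs, Matrix.cons_val_zero,
        Matrix.cons_val_one]
      nlinarith

namespace IsCAT0

variable {X : Type*} [MetricSpace X] (hX : IsCAT0 X)

/-- A geodesic from `v` to `y`, parametrised proportionally to arc length on `[0, 1]`. -/
noncomputable def contract (v y : X) (t : ℝ) : X :=
  (hX.exists_geodesic v y).choose (t * dist v y)

theorem contract_one (v y : X) : hX.contract v y 1 = y := by
  rw [contract, one_mul]
  exact (hX.exists_geodesic v y).choose_spec.target

theorem mul_dist_mem_Icc {t : ℝ} (ht : t ∈ Set.Icc (0 : ℝ) 1) (v y : X) :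
    t * dist v y ∈ Set.Icc 0 (dist v y) :=
  ⟨mul_nonneg ht.1 dist_nonneg, mul_le_of_le_one_left dist_nonneg ht.2⟩

theorem dist_contract (v y : X) {t : ℝ} (ht : t ∈ Set.Icc (0 : ℝ) 1) :
    dist v (hX.contract v y t) = t * dist v y := by
  have h := (hX.exists_geodesic v y).choose_spec
  have h1 := h.isometry 0 ⟨le_rfl, dist_nonneg⟩ _ (mul_dist_mem_Icc ht v y)
  rw [h.source] at h1
  rw [contract, h1, zero_sub, abs_neg, abs_of_nonneg (mul_nonneg ht.1 dist_nonneg)]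

theorem dist_contract_right (v y : X) {t : ℝ} (ht : t ∈ Set.Icc (0 : ℝ) 1) :
    dist (hX.contract v y t) y = (1 - t) * dist v y := by
  have h := (hX.exists_geodesic v y).choose_spec
  have h1 := h.isometry _ (mul_dist_mem_Icc ht v y) _ ⟨dist_nonneg, le_rfl⟩
  rw [h.target] at h1
  rw [contract, h1, show t * dist v y - dist v y = -((1 - t) * dist v y) by ring, abs_neg,
    abs_of_nonneg (mul_nonneg (by linarith [ht.2]) dist_nonneg)]

/-- The comparison inequality, in terms of `contract`. -/
theorem exists_comparison (v y z : X) : ∃ v' y' z' : EuclideanSpace ℝ (Fin 2),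
    dist v' y' = dist v y ∧ dist y' z' = dist y z ∧ dist v' z' = dist v z ∧
    ∀ s ∈ Set.Icc (0 : ℝ) 1, ∀ t ∈ Set.Icc (0 : ℝ) 1,
      dist (hX.contract v y s) (hX.contract v z t) ≤
        dist (AffineMap.lineMap v' y' s) (AffineMap.lineMap v' z' t) := by
  obtain ⟨v', y', z', h1, h2, h3⟩ := exists_comparison_triangle (dist_nonneg (x := v) (y := y))
    (dist_nonneg (x := v) (y := z)) (dist_triangle_left y z v)
    ((dist_triangle_right v y z).trans (by linarith)) (dist_triangle v y z)
  refine ⟨v', y', z', h1, h2, h3, fun s hs t ht => ?_⟩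
  refine hX.comparison v y z _ _ (hX.exists_geodesic v y).choose_spec
    (hX.exists_geodesic v z).choose_spec v' y' z' h1 h2 h3 _ (mul_dist_mem_Icc hs v y) _
    (mul_dist_mem_Icc ht v z) _ ?_ _ ?_ ?_ ?_
  · rw [segment_eq_image_lineMap]
    exact ⟨s, hs, rfl⟩
  · rw [segment_eq_image_lineMap]
    exact ⟨t, ht, rfl⟩
  · rw [dist_left_lineMap, Real.norm_of_nonneg hs.1, h1]
  · rw [dist_left_lineMap, Real.norm_of_nonneg ht.1, h3]

/-- In the comparison triangle, cross to the other side at the same ratio `s`, which scales the side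
`y' z'` by `s`, and then move along that side. -/
theorem dist_contract_contract_le (v y z : X) {s t : ℝ} (hs : s ∈ Set.Icc (0 : ℝ) 1)
    (ht : t ∈ Set.Icc (0 : ℝ) 1) :
    dist (hX.contract v y s) (hX.contract v z t) ≤ dist y z + |s - t| * dist v z := by
  obtain ⟨v', y', z', -, h2, h3, h⟩ := hX.exists_comparison v y z
  refine (h s hs t ht).trans ((dist_triangle _ (AffineMap.lineMap v' z' s) _).trans ?_)
  refine add_le_add ?_ ?_
  · rw [← h2, dist_eq_norm, dist_eq_norm]
    have : (AffineMap.lineMap v' y' s : EuclideanSpace ℝ (Fin 2)) - AffineMap.lineMap v' z' s =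
        s • (y' - z') := by
      simp only [AffineMap.lineMap_apply_module]
      module
    rw [this, norm_smul, Real.norm_of_nonneg hs.1]
    exact mul_le_of_le_one_left (norm_nonneg _) hs.2
  · rw [dist_lineMap_lineMap, h3, Real.dist_eq]

/-- Convexity of balls is inherited from the plane through the comparison triangle with third vertex
`a`. -/
theorem contract_mem_closedBall {v y a : X} {r : ℝ} (hv : v ∈ Metric.closedBall a r)
    (hy : y ∈ Metric.closedBall a r) {t : ℝ} (ht : t ∈ Set.Icc (0 : ℝ) 1) :
    hX.contract v y t ∈ Metric.closedBall a r := by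
  obtain ⟨v', y', a', h1, h2, h3, h⟩ := hX.exists_comparison v y a
  have h4 := h t ht 1 ⟨zero_le_one, le_rfl⟩
  rw [hX.contract_one, AffineMap.lineMap_apply_one] at h4
  refine h4.trans ((convex_closedBall a' r).segment_subset (x := v') (y := y') ?_ ?_ ?_)
  · rw [Metric.mem_closedBall, h3]
    exact hv
  · rw [Metric.mem_closedBall, h2]
    exact hy
  · rw [segment_eq_image_lineMap]
    exact ⟨t, ht, rfl⟩

theorem continuous_contract {T : Type*} [TopologicalSpace T] (v : X) {f : T → X} {t : T → ℝ}
    (hf : Continuous f) (ht : Continuous t) (htI : ∀ x, t x ∈ Set.Icc (0 : ℝ) 1) :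
    Continuous fun x => hX.contract v (f x) (t x) := by
  rw [continuous_iff_continuousAt]
  intro x
  rw [ContinuousAt, tendsto_iff_dist_tendsto_zero]
  refine squeeze_zero (fun _ => dist_nonneg)
    (fun x' => hX.dist_contract_contract_le v (f x') (f x) (htI x') (htI x)) ?_
  have : Continuous fun x' => dist (f x') (f x) + |t x' - t x| * dist v (f x) := by fun_prop
  simpa using this.tendsto x

end IsCAT0

/-! ### Geodesic cones over singular simplices -/

/-- The normalised projection of a point of a standard simplex from the zeroth vertex to the
opposite face. -/
noncomputable def stdSimplexTail {q : ℕ} (x : stdSimplex ℝ (Fin (q + 1))) (hx : x 0 < 1) :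
    stdSimplex ℝ (Fin q) :=
  ⟨fun k => x k.succ / (1 - x 0), fun k => div_nonneg (x.2.1 _) (by linarith), by
    have h := stdSimplex.sum_eq_one x
    rw [Fin.sum_univ_succ] at h
    rw [← Finset.sum_div, div_eq_one_iff_eq (by linarith)]
    linarith⟩

theorem stdSimplexTail_apply {q : ℕ} (x : stdSimplex ℝ (Fin (q + 1))) (hx : x 0 < 1)
    (k : Fin q) : stdSimplexTail x hx k = x k.succ / (1 - x 0) := rfl

theorem stdSimplex.map_succAbove_self {q : ℕ} (k : Fin (q + 1)) (x : stdSimplex ℝ (Fin q)) :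
    stdSimplex.map k.succAbove x k = 0 := by
  simp [FunOnFinite.linearMap_apply_apply]

theorem stdSimplex.map_succAbove_succAbove {q : ℕ} (k : Fin (q + 1)) (x : stdSimplex ℝ (Fin q))
    (l : Fin q) : stdSimplex.map k.succAbove x (k.succAbove l) = x l := by
  simp [FunOnFinite.linearMap_apply_apply, Finset.filter_eq']

theorem stdSimplex.continuous_apply {q : ℕ} (k : Fin q) :
    Continuous fun x : stdSimplex ℝ (Fin q) => x k :=
  (_root_.continuous_apply k).comp continuous_subtype_val

theorem stdSimplex.one_sub_mem_Icc {q : ℕ} (x : stdSimplex ℝ (Fin q)) (k : Fin q) :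
    1 - x k ∈ Set.Icc (0 : ℝ) 1 :=
  ⟨sub_nonneg.mpr (stdSimplex.le_one x k), sub_le_self _ (stdSimplex.zero_le x k)⟩

namespace IsCAT0

variable {X : Type*} [MetricSpace X] (hX : IsCAT0 X)

open Classical in
/-- The geodesic cone with apex `v` over a singular simplex. -/
noncomputable def coneSimplex {q : ℕ} (v : X) (σ : AugSimplex X q) : AugSimplex X (q + 1) where
  toFun x := if hx : x 0 < 1 then hX.contract v (σ (stdSimplexTail x hx)) (1 - x 0) else v
  continuous_toFun := by
    rw [continuous_iff_continuousAt]
    intro x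
    by_cases hx : x 0 < 1
    · have hopen : IsOpen {x : stdSimplex ℝ (Fin (q + 1)) | x 0 < 1} :=
        isOpen_lt (stdSimplex.continuous_apply 0) continuous_const
      refine ContinuousOn.continuousAt ?_ (hopen.mem_nhds hx)
      rw [continuousOn_iff_continuous_domRestrict]
      have hzero : Continuous fun x : {x : stdSimplex ℝ (Fin (q + 1)) | x 0 < 1} => 1 - x.1 0 :=
        continuous_const.sub
          ((stdSimplex.continuous_apply (q := q + 1) 0).comp continuous_subtype_val)
      have htail : Continuous fun x : {x : stdSimplex ℝ (Fin (q + 1)) | x 0 < 1} =>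
          stdSimplexTail x.1 x.2 := by
        refine Continuous.subtype_mk (continuous_pi fun k => ?_) _
        refine Continuous.div ((stdSimplex.continuous_apply _).comp continuous_subtype_val)
          hzero fun x => ?_
        have := x.2
        simp only [Set.mem_ofPred_eq] at this
        linarith
      refine (hX.continuous_contract v (σ.continuous.comp htail) hzero fun x =>
        stdSimplex.one_sub_mem_Icc _ _).congr fun x => ?_
      have := x.2
      simp only [Set.mem_ofPred_eq] at this
      simp [this]
    -- Continuity at the apex: the compact base lies within `D` of `v`, so distances to `v` shrink
    -- with `1 - x' 0`. If the base is empty, `D` may be negative, hence `max D 0`.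
    · obtain ⟨D, hD⟩ := (isCompact_range σ.continuous).isBounded.subset_closedBall v
      rw [ContinuousAt, dif_neg hx, tendsto_iff_dist_tendsto_zero]
      refine squeeze_zero (g := fun x' => (1 - x' 0) * max D 0) (fun _ => dist_nonneg)
        (fun x' => ?_) ?_
      · have h0 := stdSimplex.one_sub_mem_Icc x' 0
        split_ifs with hx'
        · rw [dist_comm, hX.dist_contract v _ h0]
          refine mul_le_mul_of_nonneg_left ?_ h0.1
          have := hD ⟨stdSimplexTail x' hx', rfl⟩
          rw [Metric.mem_closedBall, dist_comm] at this
          exact this.trans (le_max_left _ _)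
        · rw [dist_self]
          exact mul_nonneg h0.1 (le_max_right _ _)
      · have : Continuous fun x' : stdSimplex ℝ (Fin (q + 1)) => (1 - x' 0) * max D 0 :=
          (continuous_const.sub (stdSimplex.continuous_apply 0)).mul continuous_const
        have h1 : x 0 = 1 := le_antisymm (stdSimplex.le_one x 0) (not_lt.mp hx)
        simpa [h1] using this.tendsto x

theorem coneSimplex_apply_of_lt {q : ℕ} (v : X) (σ : AugSimplex X q)
    (x : stdSimplex ℝ (Fin (q + 1))) (hx : x 0 < 1) :
    hX.coneSimplex v σ x = hX.contract v (σ (stdSimplexTail x hx)) (1 - x 0) :=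
  dif_pos hx

theorem coneSimplex_apply_of_not_lt {q : ℕ} (v : X) (σ : AugSimplex X q)
    (x : stdSimplex ℝ (Fin (q + 1))) (hx : ¬ x 0 < 1) : hX.coneSimplex v σ x = v :=
  dif_neg hx

theorem coneSimplex_mem_closedBall {q : ℕ} {v a : X} {r : ℝ} {σ : AugSimplex X q}
    (hv : v ∈ Metric.closedBall a r) (hσ : ∀ x, σ x ∈ Metric.closedBall a r)
    (x : stdSimplex ℝ (Fin (q + 1))) : hX.coneSimplex v σ x ∈ Metric.closedBall a r := by
  by_cases hx : x 0 < 1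
  · rw [coneSimplex_apply_of_lt _ _ _ _ hx]
    exact hX.contract_mem_closedBall hv (hσ _) (stdSimplex.one_sub_mem_Icc _ _)
  · rwa [coneSimplex_apply_of_not_lt _ _ _ _ hx]

/-- Singular simplices of a CAT(0) space, with geodesic cones. -/
noncomputable def singSystem : ConeSystem (AugSimplex X) X where
  face := AugSimplex.face
  cone := hX.coneSimplex
  face_face σ _ _ h := σ.face_face h
  face_cone_zero v σ := by
    ext x
    rw [AugSimplex.face_apply]
    have h0 : stdSimplex.map (Fin.succAbove 0) x 0 = 0 := stdSimplex.map_succAbove_self 0 x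
    have hx : stdSimplex.map (Fin.succAbove 0) x 0 < 1 := h0.trans_lt one_pos
    have htail : stdSimplexTail _ hx = x := by
      ext k
      rw [stdSimplexTail_apply, h0, sub_zero, div_one]
      exact stdSimplex.map_succAbove_succAbove 0 x k
    rw [coneSimplex_apply_of_lt _ _ _ _ hx, htail, h0, sub_zero, contract_one]
  face_cone_succ v σ k := by
    ext x
    rw [AugSimplex.face_apply]
    have h0 : stdSimplex.map k.succ.succAbove x 0 = x 0 := by
      have := stdSimplex.map_succAbove_succAbove k.succ x 0
      rwa [Fin.succAbove_ne_zero_zero (Fin.succ_ne_zero k)] at this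
    by_cases hx : x 0 < 1
    · have hx' : stdSimplex.map k.succ.succAbove x 0 < 1 := h0.trans_lt hx
      -- Projection from the apex commutes with the inclusion of a face that contains the apex.
      have htail : stdSimplexTail _ hx' = stdSimplex.map k.succAbove (stdSimplexTail x hx) := by
        ext i
        rw [stdSimplexTail_apply, h0]
        rcases Fin.eq_self_or_eq_succAbove k i with rfl | ⟨l, rfl⟩
        · rw [stdSimplex.map_succAbove_self, stdSimplex.map_succAbove_self, zero_div]
        · rw [← Fin.succ_succAbove_succ, stdSimplex.map_succAbove_succAbove,
            stdSimplex.map_succAbove_succAbove, stdSimplexTail_apply]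
      rw [coneSimplex_apply_of_lt _ _ _ _ hx', coneSimplex_apply_of_lt _ _ _ _ hx, htail, h0,
        AugSimplex.face_apply]
    · have hx' : ¬ stdSimplex.map k.succ.succAbove x 0 < 1 := by rwa [h0]
      rw [coneSimplex_apply_of_not_lt _ _ _ _ hx', coneSimplex_apply_of_not_lt _ _ _ _ hx]

end IsCAT0

namespace ConeSystem

variable {S : ℕ → Type*} {V : Type*} (P : ConeSystem S V)

theorem ev_add {α : Type*} (c d : α → ℤ) (x : α →₀ ℤ) : ev (c + d) x = ev c x + ev d x := by
  simp [ev, Finsupp.linearCombination_apply, Finsupp.sum, mul_add, Finset.sum_add_distrib]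

theorem ev_comp_single {α β : Type*} (c : β → ℤ) (L : (α →₀ ℤ) →ₗ[ℤ] (β →₀ ℤ)) (x : α →₀ ℤ) :
    ev (fun a => ev c (L (Finsupp.single a 1))) x = ev c (L x) := by
  have : ev (fun a => ev c (L (Finsupp.single a 1))) = (ev c).comp L :=
    Finsupp.lhom_ext' fun s => LinearMap.ext_ring (by simp)
  exact LinearMap.congr_fun this x

theorem ev_coneChain {q : ℕ} (v : V) (c : S (q + 1) → ℤ) (x : S q →₀ ℤ) :
    ev (fun s => c (P.cone v s)) x = ev c (P.coneChain v x) := by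
  rw [← ev_comp_single]
  simp

/-- Coning to a point turns a cocycle into a primitive of it. -/
theorem cobd_cone {q : ℕ} (v : V) {c : S (q + 2) → ℤ} (hc : P.cobd c = 0) :
    P.cobd (fun s : S (q + 1) => c (P.cone v s)) = c := by
  funext s
  have h := ev_bd P c (P.coneChain v (Finsupp.single s 1))
  rw [hc, bd_coneChain, map_sub, ev_single, ← ev_coneChain, ev_bd_single,
    ev_eq_zero (c := 0) (W := Set.univ) (fun _ _ => rfl) (by simp)] at h
  linarith

end ConeSystem

theorem augCobd_add {X : Type*} [TopologicalSpace X] {q : ℕ} (c d : AugSimplex X q → ℤ) :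
    augCobd (c + d) = augCobd c + augCobd d := by
  funext σ
  simp [augCobd, mul_add, Finset.sum_add_distrib]

theorem augCobd_sub {X : Type*} [TopologicalSpace X] {q : ℕ} (c d : AugSimplex X q → ℤ) :
    augCobd (c - d) = augCobd c - augCobd d := by
  funext σ
  simp [augCobd, mul_sub, Finset.sum_sub_distrib]

/-! ### Cocycles far from a base point -/

namespace IsCAT0

open ConeSystem

variable {X : Type*} [MetricSpace X] (hX : IsCAT0 X)

include hX in
theorem augCobd_augCobd {q : ℕ} (c : AugSimplex X q → ℤ) : augCobd (augCobd c) = 0 :=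
  hX.singSystem.cobd_cobd c

include hX in
/-- In a proper CAT(0) space, far away points can be moved most of the way towards the ball of
radius `R` around `p₀`, to points of a finite set. -/
theorem exists_finite_net [ProperSpace X] (p₀ : X) {R : ℝ} (hR : 0 < R) :
    ∃ (N : Set X) (φ : X → X), N.Finite ∧ (∀ x, φ x ∈ N) ∧
      ∀ x, R + 3 ≤ dist x p₀ → dist x (φ x) ≤ dist x p₀ - (R + 2) := by
  obtain ⟨N, -, hN, hcover⟩ := (isCompact_closedBall p₀ (R + 3)).finite_cover_balls one_pos
  have : ∀ x, ∃ y ∈ insert p₀ N, R + 3 ≤ dist x p₀ → dist x y ≤ dist x p₀ - (R + 2) := by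
    intro x
    by_cases hx : R + 3 ≤ dist x p₀
    · have hpos : 0 < dist p₀ x := by
        rw [dist_comm]
        linarith
      -- This parameter marks the point of the geodesic at distance `R + 3` from `p₀`; passing to a
      -- net point within 1 turns `R + 3` into `R + 2`.
      have ht : (R + 3) / dist p₀ x ∈ Set.Icc (0 : ℝ) 1 := by
        refine ⟨by positivity, (div_le_one hpos).mpr ?_⟩
        rwa [dist_comm]
      have h1 := hX.dist_contract p₀ x ht
      have h2 := hX.dist_contract_right p₀ x ht
      rw [div_mul_cancel₀ _ hpos.ne'] at h1
      rw [sub_mul, one_mul, div_mul_cancel₀ _ hpos.ne'] at h2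
      have h3 := hcover (Metric.mem_closedBall'.mpr h1.le)
      simp only [Set.mem_iUnion, Metric.mem_ball] at h3
      obtain ⟨y, hy, hy'⟩ := h3
      refine ⟨y, Set.mem_insert_of_mem _ hy, fun _ => ?_⟩
      have h4 := dist_triangle_left x y (hX.contract p₀ x ((R + 3) / dist p₀ x))
      rw [dist_comm x p₀]
      linarith
    · exact ⟨p₀, Set.mem_insert _ _, fun h => absurd h hx⟩
  choose φ hφ hφ' using this
  exact ⟨insert p₀ N, φ, hN.insert p₀, hφ, hφ'⟩

/-- The zeroth vertex of a singular simplex, moved by `φ`. -/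
noncomputable def movedVertex (φ : X → X) {q : ℕ} (σ : AugSimplex X (q + 1)) : X :=
  φ (σ (stdSimplex.vertex 0))

/-- A cocycle that vanishes on the chains obtained by moving the vertices of simplices into a finite
net is a coboundary far away. -/
theorem exists_eq_augCobd {p₀ : X} {R : ℝ} {φ : X → X}
    (hφ : ∀ x, R + 3 ≤ dist x p₀ → dist x (φ x) ≤ dist x p₀ - (R + 2)) {q : ℕ}
    {f : AugSimplex X (q + 1) → ℤ}
    (hf : ∀ τ : AugSimplex X (q + 2), (∀ x, R ≤ dist (τ x) p₀) → augCobd f τ = 0)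
    (hf' : ∀ σ, ev f (hX.singSystem.subdiv (movedVertex φ) (q + 1) (Finsupp.single σ 1)) = 0) :
    ∃ e : AugSimplex X q → ℤ, ∀ σ : AugSimplex X (q + 1), (∀ x, R + 3 ≤ dist (σ x) p₀) →
      f σ = augCobd e σ := by
  let P := hX.singSystem
  let e₁ : AugSimplex X q → ℤ := fun τ =>
    ev f (P.subdivHomotopy (movedVertex φ) q (Finsupp.single τ 1))
  have hsmall : ∀ σ : AugSimplex X (q + 1), (∀ x, σ x ∈ {y | R + 3 ≤ dist y p₀}) →
      (∀ x y, dist (σ x) (σ y) ≤ 1) → (f - augCobd e₁) σ = 0 := by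
    intro σ hσ hd
    set a := σ (stdSimplex.vertex 0) with ha
    -- The largest ball around `a` forced to avoid the open `R`-ball at `p₀`. It contains the moved
    -- points: they are within 1 + (dist a p₀ + 1) − (R + 2) of `a`.
    let B := Metric.closedBall a (dist a p₀ - R)
    have haR : R + 3 ≤ dist a p₀ := hσ _
    have hmem : P.subdivHomotopy (movedVertex φ) (q + 1) (Finsupp.single σ 1) ∈
        Finsupp.supported ℤ ℤ {τ : AugSimplex X (q + 2) | ∀ x, τ x ∈ B} := by
      refine subdivHomotopy_mem_supported
        (W := fun r => {τ : AugSimplex X r | ∀ x, τ x ∈ B ∧ φ (τ x) ∈ B})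
        (W' := fun r => {τ : AugSimplex X r | ∀ x, τ x ∈ B})
        (fun τ hτ k x => hτ _) (fun r τ hτ x => (hτ x).1)
        (fun τ hτ _ t ht x => hX.coneSimplex_mem_closedBall (hτ _).2 ht x)
        (Finsupp.single_mem_supported ℤ _ fun x => ?_)
      have h1 := hd x (stdSimplex.vertex 0)
      have h2 := hφ (σ x) (hσ x)
      have h3 := dist_triangle_left (φ (σ x)) a (σ x)
      have h4 := dist_triangle (σ x) a p₀
      rw [← ha] at h1
      constructor <;> rw [Metric.mem_closedBall] <;> linarith
    -- Evaluating `f` on the homotopy formula kills the boundary term, as the homotopy avoids the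
    -- `R`-ball, and the subdivided term by `hf'`; what is left is `f σ = augCobd e₁ σ`.
    have h1 := congrArg (ev f) (bd_subdivHomotopy (P := P) (p := movedVertex φ)
      (Finsupp.single σ 1))
    have h2 := ev_bd P f (P.subdivHomotopy (movedVertex φ) (q + 1) (Finsupp.single σ 1))
    rw [ev_eq_zero (c := P.cobd f) (fun τ hτ => hf τ fun x => ?_) hmem] at h2
    · replace h1 := h2.symm.trans h1
      rw [map_sub, map_sub, hf', ev_single] at h1
      have h3 : augCobd e₁ σ =
          ev f (P.subdivHomotopy (movedVertex φ) q (P.bd (Finsupp.single σ 1))) :=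
        (ev_bd_single P e₁ σ).symm.trans (ev_comp_single f _ _)
      rw [Pi.sub_apply, h3]
      linarith
    · have h5 := hτ x
      rw [Metric.mem_closedBall] at h5
      have h6 := dist_triangle_left a p₀ (τ x)
      linarith
  refine ⟨e₁ + smallPrimitive (f - augCobd e₁), fun σ hσ => ?_⟩
  have h := eq_augCobd_smallPrimitive (f - augCobd e₁) hsmall (fun τ hτ => ?_) σ hσ
  · rw [augCobd_add, Pi.add_apply, ← h, Pi.sub_apply]
    ring
  · rw [augCobd_sub, hX.augCobd_augCobd, sub_zero]
    exact hf τ fun x => by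
      have : R + 3 ≤ dist (τ x) p₀ := hτ x
      linarith

end IsCAT0

/-! ### Finite detection and uniformity around a fixed point -/

section CompactSupports

variable {X : Type*} [MetricSpace X]

theorem cochainsIn_mono {U V : Set X} (h : U ⊆ V) (n : ℕ) : cochainsIn U n ≤ cochainsIn V n :=
  fun _ ⟨K, hK, hKU, hc⟩ => ⟨K, hK, hKU.trans h, hc⟩

theorem coboundariesIn_mono {U V : Set X} (h : U ⊆ V) :
    ∀ n : ℕ, coboundariesIn U n ≤ coboundariesIn V n
  | 0 => le_rfl
  | n + 1 => AddSubgroup.map_mono (cochainsIn_mono h n)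

theorem exists_mem_coboundariesIn_ball (p₀ : X) {n : ℕ} {z : SingCochain X n}
    (hz : z ∈ coboundariesIn Set.univ n) :
    ∃ s : ℕ, z ∈ coboundariesIn (Metric.ball p₀ s) n := by
  cases n with
  | zero => exact ⟨0, hz⟩
  | succ n =>
    obtain ⟨g, ⟨K, hK, -, hg⟩, rfl⟩ := hz
    obtain ⟨r, hr⟩ := hK.isBounded.subset_ball p₀
    obtain ⟨s, hs⟩ := exists_nat_ge r
    exact ⟨s, g, ⟨K, hK, hr.trans (Metric.ball_subset_ball hs), hg⟩, rfl⟩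

open ConeSystem in
/-- The uniform statement for the balls around a fixed point. -/
theorem exists_ball_of_coboundariesIn [ProperSpace X] (hX : IsCAT0 X) {n : ℕ}
    (h : cocyclesIn (Set.univ : Set X) (n + 1) ≤ coboundariesIn Set.univ (n + 1)) (p₀ : X) {R : ℝ}
    (hR : 0 < R) :
    ∃ s : ℝ, cocyclesIn (Metric.ball p₀ R) (n + 1) ≤ coboundariesIn (Metric.ball p₀ s) (n + 1) := by
  obtain ⟨N, φ, hN, hφN, hφ⟩ := hX.exists_finite_net p₀ hR
  let P := hX.singSystem
  let 𝓕 : Set (AugSimplex X (n + 1) →₀ ℤ) := Set.range fun σ : AugSimplex X (n + 1) =>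
    P.subdiv (IsCAT0.movedVertex φ) (n + 1) (Finsupp.single σ 1)
  -- This starts the induction that makes `𝓕` finite: there is only one empty simplex.
  have hsub : Subsingleton (AugSimplex X 0) :=
    ⟨fun σ τ => ContinuousMap.ext fun x => by simpa using stdSimplex.sum_eq_one x⟩
  have h𝓕 : Finite 𝓕 := finite_range_subdiv hN (fun σ => hφN _) (n + 1)
  let Θ : SingCochain X (n + 1) →+ (𝓕 → ℤ) :=
    { toFun := fun z c => ev z (P.coneChain p₀ c.1)
      map_zero' := by
        funext c
        exact ev_eq_zero (W := Set.univ) (fun _ _ => rfl) (by simp)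
      map_add' := fun z z' => by
        funext c
        exact ev_add z z' _ }
  -- The first factor keeps `z - z₁` supported in the `R`-ball when `z₁` is subtracted below.
  let Z : ℕ → AddSubgroup (SingCochain X (n + 1)) := fun s =>
    cocyclesIn (Metric.ball p₀ R) (n + 1) ⊓ coboundariesIn (Metric.ball p₀ s) (n + 1)
  let T : ℕ →o Submodule ℤ (𝓕 → ℤ) :=
    { toFun := fun s => AddSubgroup.toIntSubmodule ((Z s).map Θ)
      monotone' := fun s t hst => AddSubgroup.toIntSubmodule.monotone <| AddSubgroup.map_mono <|
        inf_le_inf_left _ <|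
          coboundariesIn_mono (Metric.ball_subset_ball (by exact_mod_cast hst)) _ }
  obtain ⟨s₀, hs₀⟩ := monotone_stabilizes_iff_noetherian.mpr inferInstance T
  refine ⟨max (R + 4) s₀, fun z hz => ?_⟩
  obtain ⟨z₁, ⟨hz₁, hz₁'⟩, hΘ⟩ : Θ z ∈ (Z s₀).map Θ := by
    obtain ⟨s, hs⟩ := exists_mem_coboundariesIn_ball p₀
      (h ⟨cochainsIn_mono (Set.subset_univ _) _ hz.1, hz.2⟩)
    -- The radius `s` depends on `z`, but stabilisation brings the value `Θ z` back to stage `s₀`.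
    have h1 : Θ z ∈ T (max s₀ s) := ⟨z, ⟨hz, coboundariesIn_mono
      (Metric.ball_subset_ball (by exact_mod_cast le_max_right s₀ s)) _ hs⟩, rfl⟩
    rw [← hs₀ _ (le_max_left _ _)] at h1
    exact h1
  have hz₂ := AddSubgroup.sub_mem _ hz hz₁
  set z₂ : AugSimplex X (n + 2) → ℤ := z - z₁ with hz₂_def
  have hΘ₂ : Θ z₂ = 0 := (map_sub Θ z z₁).trans (sub_eq_zero.mpr hΘ.symm)
  let f : AugSimplex X (n + 1) → ℤ := fun σ => z₂ (P.cone p₀ σ)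
  have hfz : augCobd f = z₂ := P.cobd_cone p₀ hz₂.2
  obtain ⟨K, hK, hKR, hK₂⟩ := hz₂.1
  obtain ⟨e, he⟩ := hX.exists_eq_augCobd hφ (f := f) (fun τ hτ => by
      rw [hfz]
      refine hK₂ τ ?_
      rintro _ ⟨x, rfl⟩ hx
      exact absurd (hKR hx) (not_lt.mpr (hτ x)))
    (fun σ => (P.ev_coneChain p₀ z₂ _).trans (congrFun hΘ₂ ⟨_, σ, rfl⟩))
  -- Beyond distance `R + 3` the cochains `f` and `augCobd e` agree. For `n = 0`, `e` lives on the
  -- empty simplex and `augCobd e` is a constant, still with zero coboundary.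
  have hz₂' : z₂ ∈ coboundariesIn (Metric.ball p₀ (R + 4)) (n + 1) := by
    refine ⟨f - augCobd e, ⟨Metric.closedBall p₀ (R + 3), isCompact_closedBall _ _,
      Metric.closedBall_subset_ball (by linarith), fun σ hσ => ?_⟩, ?_⟩
    · rw [Pi.sub_apply, sub_eq_zero]
      refine he σ fun x => ?_
      have := hσ ⟨x, rfl⟩
      rw [Set.mem_compl_iff, Metric.mem_closedBall, not_le] at this
      exact this.le
    · change augCobd (f - augCobd e) = z₂
      rw [augCobd_sub, hX.augCobd_augCobd, sub_zero, hfz]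
  have hzz : z = z₂ + z₁ := (sub_add_cancel z z₁).symm
  rw [hzz]
  exact AddSubgroup.add_mem _
    (coboundariesIn_mono (Metric.ball_subset_ball (le_max_left _ _)) _ hz₂')
    (coboundariesIn_mono (Metric.ball_subset_ball (le_max_right _ _)) _ hz₁')

/-! ### Transport by isometries -/

/-- The pullback of singular cochains along an isometry. -/
noncomputable def pullIsometry (h : X ≃ᵢ X) {n : ℕ} (c : SingCochain X n) : SingCochain X n :=
  fun σ => c ((⟨h, h.continuous⟩ : C(X, X)).comp σ)

theorem singCoboundary_pullIsometry (h : X ≃ᵢ X) {n : ℕ} (c : SingCochain X n) :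
    singCoboundary X n (pullIsometry h c) = pullIsometry h (singCoboundary X n c) := rfl

theorem pullIsometry_symm (h : X ≃ᵢ X) {n : ℕ} (c : SingCochain X n) :
    pullIsometry h.symm (pullIsometry h c) = c := by
  funext σ
  refine congrArg c ?_
  ext x
  exact h.apply_symm_apply (σ x)

theorem pullIsometry_mem_cochainsIn (h : X ≃ᵢ X) {n : ℕ} {c : SingCochain X n} {U V : Set X}
    (hUV : ∀ x ∈ U, h.symm x ∈ V) (hc : c ∈ cochainsIn U n) : pullIsometry h c ∈ cochainsIn V n := by
  obtain ⟨K, hK, hKU, hc⟩ := hc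
  refine ⟨h.symm '' K, hK.image h.symm.continuous, ?_, fun σ hσ => hc _ ?_⟩
  · rintro _ ⟨x, hx, rfl⟩
    exact hUV x (hKU hx)
  · rintro _ ⟨x, rfl⟩ hx
    exact hσ ⟨x, rfl⟩ ⟨_, hx, h.symm_apply_apply (σ x)⟩

theorem pullIsometry_mem_cocyclesIn (h : X ≃ᵢ X) {n : ℕ} {c : SingCochain X n} {U V : Set X}
    (hUV : ∀ x ∈ U, h.symm x ∈ V) (hc : c ∈ cocyclesIn U n) : pullIsometry h c ∈ cocyclesIn V n := by
  refine ⟨pullIsometry_mem_cochainsIn h hUV hc.1, ?_⟩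
  have h1 : singCoboundary X n c = 0 := hc.2
  change singCoboundary X n (pullIsometry h c) = 0
  rw [singCoboundary_pullIsometry, h1]
  rfl

theorem pullIsometry_mem_coboundariesIn (h : X ≃ᵢ X) {n : ℕ} {c : SingCochain X n} {U V : Set X}
    (hUV : ∀ x ∈ U, h.symm x ∈ V) (hc : c ∈ coboundariesIn U n) :
    pullIsometry h c ∈ coboundariesIn V n := by
  cases n with
  | zero =>
    obtain rfl : c = 0 := hc
    exact AddSubgroup.zero_mem _
  | succ n =>
    obtain ⟨g, hg, rfl⟩ := hc
    exact ⟨pullIsometry h g, pullIsometry_mem_cochainsIn h hUV hg, rfl⟩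

theorem cocyclesIn_le_coboundariesIn {n : ℕ} (h : Subsingleton (CompactCohomology X n)) :
    cocyclesIn (Set.univ : Set X) n ≤ coboundariesIn Set.univ n := by
  intro z hz
  have := (QuotientAddGroup.eq_zero_iff (⟨z, hz⟩ : cocyclesIn (Set.univ : Set X) n)).mp
    (Subsingleton.elim _ (0 : CompactCohomology X n))
  exact this

end CompactSupports

theorem proposition2p1 (X : Type*) [MetricSpace X] [ProperSpace X] (hX : IsCAT0 X)
    (hc : IsCocompactSpace X) (i : ℕ) (h : Subsingleton (CompactCohomology X i)) :
    UniformlyTrivialCompactCohomology X i := by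
  intro r hr
  have hle := cocyclesIn_le_coboundariesIn h
  cases i with
  -- In degree zero the group of coboundaries does not depend on the ball, so any radius works.
  | zero => exact ⟨1, one_pos, fun p z hz => hle ⟨cochainsIn_mono (Set.subset_univ _) _ hz.1, hz.2⟩⟩
  | succ n =>
    rcases isEmpty_or_nonempty X with hE | ⟨⟨p₀⟩⟩
    · exact ⟨1, one_pos, fun p => hE.elim p⟩
    obtain ⟨C, hC, hcover⟩ := hc
    obtain ⟨D, hD⟩ := hC.isBounded.subset_closedBall p₀
    -- An isometry brings the centre `p` within `D` of `p₀`, which costs `D` on the way there and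
    -- again on the way back; the maxima with 0 and 1 only secure positive radii.
    obtain ⟨s, hs⟩ := exists_ball_of_coboundariesIn hX hle p₀ (R := r + max D 0) (by positivity)
    refine ⟨max (s + D) 1, by positivity, fun p z hz => ?_⟩
    have hp : p ∈ ⋃ h : X ≃ᵢ X, h '' C := hcover ▸ Set.mem_univ p
    obtain ⟨g, c, hcC, rfl⟩ := Set.mem_iUnion.mp hp
    have hcD : dist c p₀ ≤ D := hD hcC
    rw [← pullIsometry_symm g z]
    refine pullIsometry_mem_coboundariesIn g.symm (fun x hx => ?_)
      (hs (pullIsometry_mem_cocyclesIn g (fun x hx => ?_) hz))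
    · rw [IsometryEquiv.symm_symm, Metric.mem_ball, g.dist_eq]
      rw [Metric.mem_ball] at hx
      have := dist_triangle_right x c p₀
      exact lt_of_lt_of_le (by linarith) (le_max_left _ _)
    · rw [Metric.mem_ball] at hx ⊢
      have h1 : dist (g.symm x) c < r := by
        rwa [← g.dist_eq, g.apply_symm_apply]
      have := dist_triangle (g.symm x) c p₀
      linarith [le_max_left D 0]
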